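/- Partitions are identified with their Young diagrams in English notation, rows and columns being numbered from $0$. A skew shape $\chi=\lambda/\mu$ is a pair of partitions with $\mu\subseteq\lambda$; its squares are those of $\lambda$ that are not in $\mu$. Let $\mathrm{Tab}(\chi)$ be the set of semistandard tableaux of shape $\chi$: fillings of the squares of $\chi$ by entries in $\mathbb N=\{0,1,2,\dots\}$ that increase weakly along rows and strictly down columns. The weight $\mathrm{wt}\,T\in\mathbb N^{(\mathbb N)}$ of $T$ has as component $k$ the number of entries of $T$ equal to $k$; a partition is identified with the sequence of its row lengths. A tableau is a Littlewood–Richardson tableau if in every prefix of the word obtained by reading its rows from top to bottom, each from right to left, there are for every $k\in\mathbb N$ at least as many letters $k$ as letters $k+1$. Let $\mathrm{LR}(\chi,\nu)$ be the set of Littlewood–Richardson tableaux in $\mathrm{Tab}(\chi)$ of weight $\nu$. The canonical tableau $\mathbf 1_\nu\in\mathrm{Tab}(\nu/0)$ has all entries in row $i$ equal to $i$, for every $i$. An inward jeu de taquin slide on $T\in\mathrm{Tab}(\lambda/\mu)$ starts with a corner $s$ of $\mu$ as empty square; as long as there is an entry immediately below or immediately to the right of the empty square, the smaller of these entries (the one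 below, in case of equality) moves into the empty square, and the square it leaves becomes the empty square. If $t$ is the final empty square, the result is a tableau of shape $(\lambda\setminus\{t\})/(\mu\setminus\{s\})$. Write $T\rhd T'$ if $T'$ is obtained from $T$ by a finite, possibly empty, sequence of inward slides. Let $s_\chi=\sum_{T\in\mathrm{Tab}(\chi)}X^{\mathrm{wt}\,T}$ be the skew Schur function in the variables $X_0,X_1,\dots$, and put $s_\nu=s_{\nu/0}$. **Corollary.** 1. If $T\rhd T'$, then $T$ is a Littlewood–Richardson tableau if and only if $T'$ is one. 2. For every $L\in\mathrm{Tab}(\chi)$ there are a partition $\nu$ and a tableau $P\in\mathrm{Tab}(\nu/0)$ with $L\rhd P$. For all such $\nu$ and $P$, $L$ is a Littlewood–Richardson tableau if and only if $P=\mathbf 1_\nu$, and in that case $\mathrm{wt}\,L=\nu$. 3. (Fibre equation) For every skew shape $\chi$ and every partition $\nu$, $$\{\,L\in\mathrm{Tab}(\chi) : L\rhd\mathbf 1_\nu\,\}=\mathrm{LR}(\chi,\nu).$$ 4. (Littlewood–Richardson rule) For every skew shape $\chi$ and all partitions $\lambda,\mu$, $$s_\chi=\sum_{\nu}\#\mathrm{LR}(\chi,\nu)\,s_\nu,\qquad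 s_\lambda s_\mu=\sum_{\nu\supseteq\lambda}\#\mathrm{LR}(\nu/\lambda,\mu)\,s_\nu,$$ where $\nu$ runs over partitions, all the sets $\mathrm{LR}(\cdot,\cdot)$ are finite, and only finitely many terms of each sum are non-zero. -/

import Mathlib

namespace LRRule

/-- A skew shape `outer / inner`; partitions are Young diagrams in English notation, a square
`(i, j)` lying in row `i` and column `j`, both counted from `0`. -/
structure SkewShape where
  outer : YoungDiagram
  inner : YoungDiagram
  le : inner ≤ outer

/-- The set of squares of a skew shape. -/
def SkewShape.cells (χ : SkewShape) : Finset (ℕ × ℕ) := χ.outer.cells \ χ.inner.cells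

/-- The partition shape `ν / 0`. -/
def SkewShape.ofPartition (ν : YoungDiagram) : SkewShape := ⟨ν, ⊥, bot_le⟩

/-- Semistandard tableaux of skew shape `χ`, with entries in `ℕ`: rows increase weakly and columns
increase strictly. The value of `entry` outside the shape is `0`, by convention. -/
@[ext]
structure Tab (χ : SkewShape) where
  entry : ℕ → ℕ → ℕ
  row_weak : ∀ {i j₁ j₂ : ℕ}, j₁ < j₂ → (i, j₁) ∈ χ.cells → (i, j₂) ∈ χ.cells →
    entry i j₁ ≤ entry i j₂
  col_strict : ∀ {i₁ i₂ j : ℕ}, i₁ < i₂ → (i₁, j) ∈ χ.cells → (i₂, j) ∈ χ.cells →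
    entry i₁ j < entry i₂ j
  zeros : ∀ {i j : ℕ}, (i, j) ∉ χ.cells → entry i j = 0

/-- The weight of a tableau: its component `k` is the number of entries equal to `k`. -/
noncomputable def Tab.wt {χ : SkewShape} (T : Tab χ) : ℕ →₀ ℕ :=
  ∑ c ∈ χ.cells, Finsupp.single (T.entry c.1 c.2) 1

/-- The canonical tableau of partition shape `ν`: all entries in row `i` are equal to `i`. -/
def canonical (ν : YoungDiagram) : Tab (SkewShape.ofPartition ν) where
  entry i j := if (i, j) ∈ (SkewShape.ofPartition ν).cells then i else 0
  row_weak := by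
    intro i j₁ j₂ _ h₁ h₂
    rw [if_pos h₁, if_pos h₂]
  col_strict := by
    intro i₁ i₂ j h h₁ h₂
    rwa [if_pos h₁, if_pos h₂]
  zeros := by
    intro i j h
    rw [if_neg h]

/-! ### Littlewood-Richardson tableaux -/

/-- The number of entries `k` of `T` among the squares that are read no later than `(r, c)` when
the rows are read from top to bottom and each row from right to left. -/
def Tab.prefixCount {χ : SkewShape} (T : Tab χ) (r c k : ℕ) : ℕ :=
  (χ.cells.filter fun p =>
    (p.1 < r ∨ (p.1 = r ∧ c ≤ p.2)) ∧ T.entry p.1 p.2 = k).card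

/-- Littlewood-Richardson tableaux: the word obtained by reading the rows from top to bottom, each
from right to left, is a lattice word, i.e. every prefix has at least as many letters `k` as
letters `k + 1`, for every `k`. -/
def Tab.IsLR {χ : SkewShape} (T : Tab χ) : Prop :=
  ∀ r c k : ℕ, T.prefixCount r c (k + 1) ≤ T.prefixCount r c k

/-- The set of Littlewood-Richardson tableaux of shape `χ` and weight `ν`. -/
def LR (χ : SkewShape) (ν : YoungDiagram) : Set (Tab χ) :=
  {T | T.IsLR ∧ ∀ k, T.wt k = ν.rowLen k}

/-! ### Jeu de taquin -/

/-- A tableau as a partial filling of the plane. -/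
def Tab.filling {χ : SkewShape} (T : Tab χ) : ℕ × ℕ → Option ℕ :=
  fun c => if c ∈ χ.cells then some (T.entry c.1 c.2) else none

/-- One move of an inward slide, on partial fillings with a marked empty square `(i, j)`: among
the entries just below and just to the right of the empty square, the smaller one moves into it
(the one below, when they are equal), and the square it leaves becomes the empty square. -/
inductive SlideStep : (ℕ × ℕ → Option ℕ) × (ℕ × ℕ) → (ℕ × ℕ → Option ℕ) × (ℕ × ℕ) → Prop
  | up (f : ℕ × ℕ → Option ℕ) (i j b : ℕ) (hb : f (i + 1, j) = some b)
      (hr : ∀ r, f (i, j + 1) = some r → b ≤ r) :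
      SlideStep (f, (i, j))
        (Function.update (Function.update f (i, j) (some b)) (i + 1, j) none, (i + 1, j))
  | left (f : ℕ × ℕ → Option ℕ) (i j r : ℕ) (hr : f (i, j + 1) = some r)
      (hb : ∀ b, f (i + 1, j) = some b → r < b) :
      SlideStep (f, (i, j))
        (Function.update (Function.update f (i, j) (some r)) (i, j + 1) none, (i, j + 1))

/-- `T'` is obtained from `T` by an inward jeu de taquin slide: a corner `s` of the inner partition
is made the empty square, moves are made until none is possible any more, and the final position
`t` of the empty square is removed from the outer partition. -/
def InwardSlide {χ χ' : SkewShape} (T : Tab χ) (T' : Tab χ') : Prop :=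
  ∃ s t : ℕ × ℕ,
    s ∈ χ.inner.cells ∧ χ'.inner.cells = χ.inner.cells.erase s ∧
    t ∈ χ.outer.cells ∧ χ'.outer.cells = χ.outer.cells.erase t ∧
    Relation.ReflTransGen SlideStep (T.filling, s) (T'.filling, t) ∧
    T'.filling (t.1 + 1, t.2) = none ∧ T'.filling (t.1, t.2 + 1) = none

/-- `T'` is obtained from `T` by a finite (possibly empty) sequence of inward slides. -/
def SlidesTo {χ χ' : SkewShape} (T : Tab χ) (T' : Tab χ') : Prop :=
  Relation.ReflTransGen (fun A B : (Σ ψ : SkewShape, Tab ψ) => InwardSlide A.2 B.2) ⟨χ, T⟩ ⟨χ', T'⟩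

/-! ### Schur functions -/

/-- The (skew) Schur function `s_χ`, the sum over all `T` in `Tab χ` of the monomials `X ^ wt T`,
in countably many variables `X 0, X 1, …`. -/
noncomputable def schur (χ : SkewShape) : MvPowerSeries ℕ ℤ :=
  fun d => (Nat.card {T : Tab χ // T.wt = d} : ℤ)

end LRRule

/-!
A tableau is encoded by the numbers `g k i`, the first column of row `i` occupied neither by the
inner shape nor by an entry `< k`; weak rows and strict columns become the interlacing inequalities
`g (k + 1) (i + 1) ≤ g k i`. A tableau is Littlewood-Richardson exactly when, for all `j` and `k`,
the columns `≥ j` contain at least as many entries `k` as `k + 1`. A vertical move of the empty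
square does not affect these counts, and a move from column `j + 1` to column `j` only affects the
count at `j + 1`, where the inequality follows from a neighbouring one; hence the property is
invariant under slides. On a partition shape it forces every entry to be at most its row number,
and strictness down columns forces the converse inequality.

The Littlewood-Richardson rule follows Stembridge. In `n` variables, the Bender-Knuth symmetry of
`s_χ` expands `a_(κ + ρ) * s_χ` as the sum of `a_(κ + ρ + wt T)` over the tableaux `T` of shape
`χ`. The tableaux violating dominance relative to `κ` cancel in pairs, by a Bender-Knuth involution
applied to the columns before the last violating one. The case `κ = 0` is the rule for skew Schur
functions; the case `κ = lam`, `χ = mu` is the rule for products, where dominant tableaux become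
Littlewood-Richardson tableaux of shape `ν/lam` and weight `mu` by exchanging rows and letters.
-/

namespace LRRule

/-! ### Interlacing chains -/

/-- Interlacing chains from `b` to `t` in `n` steps, of sequences supported in `{0, …, n - 1}`.
A tableau with letters less than `n` and at most `n` rows is encoded by the chain in which
`val k i` is the first column of row `i` that is not occupied by the inner shape or by a letter
less than `k`. -/
@[ext]
structure InterlacingChain (n : ℕ) (b t : ℕ → ℕ) where
  val : ℕ → ℕ → ℕ
  base : val 0 = b
  top : ∀ k, n ≤ k → val k = t
  mono : ∀ k i, val k i ≤ val (k + 1) i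
  inter : ∀ k i, val (k + 1) (i + 1) ≤ val k i
  supp : ∀ i, n ≤ i → t i = 0

/-- The number of letters `k` in row `i` of the tableau encoded by `g`. -/
def mult (g : ℕ → ℕ → ℕ) (i k : ℕ) : ℕ := g (k + 1) i - g k i

/-- The number of letters `k` in the first `n` rows of the tableau encoded by `g`. -/
def chainWt (n : ℕ) (g : ℕ → ℕ → ℕ) (k : ℕ) : ℕ := ∑ i ∈ Finset.range n, mult g i k

/-- The number of letters `k` in the first `n` rows and in the columns from `j` on. -/
def countFromCol (n : ℕ) (g : ℕ → ℕ → ℕ) (j k : ℕ) : ℕ :=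
  ∑ i ∈ Finset.range n, (max (g (k + 1) i) j - max (g k i) j)

/-- Dominance relative to the partition `κ`, for the row reading: adding to `κ` the weight of any
prefix gives a partition. Only the prefixes that end just before the letters `k` of a row need to
be tested. For `κ = 0` this is the Littlewood-Richardson condition. -/
def IsRowDominant (κ : ℕ → ℕ) (g : ℕ → ℕ → ℕ) : Prop :=
  ∀ i k, κ (k + 1) + ∑ i' ∈ Finset.range (i + 1), mult g i' (k + 1) ≤
    κ k + ∑ i' ∈ Finset.range i, mult g i' k

/-- Dominance relative to the partition `κ`, for the column reading: adding to `κ` the weight of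
any final set of columns gives a partition. -/
def IsColDominant (n : ℕ) (κ : ℕ → ℕ) (g : ℕ → ℕ → ℕ) : Prop :=
  ∀ j k, κ (k + 1) + countFromCol n g j (k + 1) ≤ κ k + countFromCol n g j k

namespace InterlacingChain

variable {n : ℕ} {b t : ℕ → ℕ} (g : InterlacingChain n b t)

theorem monotone_val (i : ℕ) : Monotone fun k => g.val k i :=
  monotone_nat_of_le_succ fun k => g.mono k i

theorem antitone_val (k : ℕ) : Antitone (g.val k) :=
  antitone_nat_of_succ_le fun i => (g.mono k (i + 1)).trans (g.inter k i)

theorem inter_of_lt (k : ℕ) {i i' : ℕ} (h : i < i') : g.val (k + 1) i' ≤ g.val k i :=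
  (g.antitone_val (k + 1) h).trans (g.inter k i)

theorem le_top (k i : ℕ) : g.val k i ≤ t i := by
  have h := g.monotone_val i (le_max_left k n)
  simpa [g.top _ (le_max_right k n)] using h

theorem val_eq_zero (k : ℕ) {i : ℕ} (hi : n ≤ i) : g.val k i = 0 :=
  Nat.le_zero.1 ((g.le_top k i).trans (g.supp i hi).le)

theorem mult_eq_zero_of_row {i : ℕ} (hi : n ≤ i) (k : ℕ) : mult g.val i k = 0 := by
  simp [mult, g.val_eq_zero _ hi]

theorem mult_eq_zero_of_letter (i : ℕ) {k : ℕ} (hk : n ≤ k) : mult g.val i k = 0 := by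
  simp [mult, g.top k hk, g.top (k + 1) (by omega)]

theorem val_add_mult (k i : ℕ) : g.val k i + mult g.val i k = g.val (k + 1) i :=
  Nat.add_sub_cancel' (g.mono k i)

theorem val_eq_add_sum (k i : ℕ) :
    g.val k i = b i + ∑ k' ∈ Finset.range k, mult g.val i k' := by
  induction k with
  | zero => simp [g.base]
  | succ k ih => rw [Finset.sum_range_succ, ← add_assoc, ← ih, g.val_add_mult]

theorem countFromCol_eq_zero_of_letter (j : ℕ) {k : ℕ} (hk : n ≤ k) :
    countFromCol n g.val j k = 0 := by
  simp [countFromCol, g.top k hk, g.top (k + 1) (by omega)]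

theorem sum_mult_range {N : ℕ} (h : n ≤ N) (k : ℕ) :
    ∑ i ∈ Finset.range N, mult g.val i k = chainWt n g.val k :=
  Finset.eventually_constant_sum (fun _ hi => g.mult_eq_zero_of_row hi k) h

theorem chainWt_eq_zero {k : ℕ} (hk : n ≤ k) : chainWt n g.val k = 0 :=
  Finset.sum_eq_zero fun i _ => g.mult_eq_zero_of_letter i hk

/-! ### Row dominance and column dominance -/

theorem countFromCol_eq_sum_range {j k r : ℕ} (hr : g.val (k + 1) r ≤ j) :
    countFromCol n g.val j k =
      ∑ i ∈ Finset.range r, (max (g.val (k + 1) i) j - max (g.val k i) j) := by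
  have hrow (i : ℕ) (hi : n ≤ i) : max (g.val (k + 1) i) j - max (g.val k i) j = 0 := by
    simp [g.val_eq_zero _ hi]
  have hcol (i : ℕ) (hi : r ≤ i) : max (g.val (k + 1) i) j - max (g.val k i) j = 0 := by
    have := g.antitone_val (k + 1) hi
    omega
  rw [countFromCol, ← Finset.eventually_constant_sum hrow (le_max_left n r),
    Finset.eventually_constant_sum hcol (le_max_right n r)]

theorem sum_range_max_sub_max {j k r : ℕ} (h : ∀ i < r, j ≤ g.val k i) :
    ∑ i ∈ Finset.range r, (max (g.val (k + 1) i) j - max (g.val k i) j) =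
      ∑ i ∈ Finset.range r, mult g.val i k := by
  refine Finset.sum_congr rfl fun i hi => ?_
  have hj := h i (Finset.mem_range.1 hi)
  rw [mult, max_eq_left hj, max_eq_left (hj.trans (g.mono k i))]

theorem countFromCol_succ_letter {j k r : ℕ} (hr : g.val (k + 1) r ≤ j)
    (hlt : ∀ i < r, j ≤ g.val (k + 1) i) :
    countFromCol n g.val j (k + 1) =
      ∑ i ∈ Finset.range r, mult g.val i (k + 1) + (g.val (k + 1 + 1) r - j) := by
  rw [g.countFromCol_eq_sum_range ((g.inter (k + 1) r).trans hr), Finset.sum_range_succ,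
    g.sum_range_max_sub_max hlt, max_eq_right hr]
  congr 1
  omega

end InterlacingChain

variable {n : ℕ} {b t κ : ℕ → ℕ} {g : InterlacingChain n b t}

theorem IsRowDominant.isColDominant (h : IsRowDominant κ g.val) :
    IsColDominant n κ g.val := by
  intro j k
  have hex : ∃ r, g.val (k + 1) r ≤ j := ⟨n, by simp [g.val_eq_zero _ le_rfl]⟩
  obtain ⟨r, hr, hlt⟩ : ∃ r, g.val (k + 1) r ≤ j ∧ ∀ i < r, j ≤ g.val (k + 1) i :=
    ⟨Nat.find hex, Nat.find_spec hex, fun i hi => (not_le.1 (Nat.find_min hex hi)).le⟩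
  have hrow := h r k
  rw [Finset.sum_range_succ, mult] at hrow
  rw [g.countFromCol_succ_letter hr hlt, g.countFromCol_eq_sum_range hr]
  rcases r with _ | r
  · simp only [Finset.range_zero, Finset.sum_empty] at hrow ⊢
    omega
  have hfull : ∀ i < r, j ≤ g.val k i := fun i hi =>
    (hlt (i + 1) (by omega)).trans (g.inter k i)
  have hprev := h r k
  have hj := hlt r (by omega)
  have hmono := g.mono k r
  have hinter := g.inter (k + 1) r
  rw [Finset.sum_range_succ (fun i => mult g.val i k), mult.eq_1 _ _ k] at hrow
  rw [Finset.sum_range_succ (fun i => max (g.val (k + 1) i) j - max (g.val k i) j),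
    g.sum_range_max_sub_max hfull]
  omega

theorem IsColDominant.isRowDominant (h : IsColDominant n κ g.val) :
    IsRowDominant κ g.val := by
  intro i k
  have hfull : ∀ i' < i, g.val (k + 1) i ≤ g.val k i' := fun i' hi' => g.inter_of_lt k hi'
  have hcol := h (g.val (k + 1) i) k
  rwa [g.countFromCol_succ_letter le_rfl fun i' hi' => g.antitone_val (k + 1) hi'.le,
    g.countFromCol_eq_sum_range le_rfl, g.sum_range_max_sub_max hfull,
    ← mult.eq_1 g.val i (k + 1), ← Finset.sum_range_succ] at hcol

theorem isRowDominant_iff_isColDominant :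
    IsRowDominant κ g.val ↔ IsColDominant n κ g.val :=
  ⟨IsRowDominant.isColDominant, IsColDominant.isRowDominant⟩

/-! ### Bender-Knuth involutions on initial sets of columns -/

/-- The largest value that a chain may take at `(k + 1, i)`, the other values being fixed. -/
def upper (g : ℕ → ℕ → ℕ) (k i : ℕ) : ℕ :=
  if i = 0 then g (k + 2) 0 else min (g (k + 2) i) (g k (i - 1))

/-- The smallest value that a chain may take at `(k + 1, i)`, the other values being fixed. -/
def lower (g : ℕ → ℕ → ℕ) (k i : ℕ) : ℕ := max (g k i) (g (k + 2) (i + 1))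

/-- The Bender-Knuth involution exchanging the numbers of letters `k` and `k + 1`, applied to the
columns before `j` only: it reflects the part of `g (k + 1) i` before column `j` in the interval
of its possible values. -/
def toggleVal (j k : ℕ) (g : ℕ → ℕ → ℕ) (k' i : ℕ) : ℕ :=
  if k' = k + 1 then
    min (upper g k i) j + min (lower g k i) j - min (g (k + 1) i) j + (g (k + 1) i - j)
  else g k' i

/-- Column `j` of the tableau encoded by `g` has no letter `k`. This is what makes the part of the
tableau before column `j` independent of the part from column `j` on, as far as the letters `k` and
`k + 1` are concerned. -/
def ColAvoids (j k : ℕ) (g : ℕ → ℕ → ℕ) : Prop := ∀ i, j < g k i ∨ g (k + 1) i ≤ j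

theorem toggleVal_of_ne {j k k' : ℕ} (g : ℕ → ℕ → ℕ) (i : ℕ) (h : k' ≠ k + 1) :
    toggleVal j k g k' i = g k' i := if_neg h

theorem toggleVal_self (j k : ℕ) (g : ℕ → ℕ → ℕ) (i : ℕ) :
    toggleVal j k g (k + 1) i =
      min (upper g k i) j + min (lower g k i) j - min (g (k + 1) i) j + (g (k + 1) i - j) :=
  if_pos rfl

theorem upper_le (g : ℕ → ℕ → ℕ) (k i : ℕ) : upper g k i ≤ g (k + 2) i := by
  rw [upper]
  split_ifs with h
  · rw [h]
  · exact min_le_left _ _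

theorem upper_succ_le (g : ℕ → ℕ → ℕ) (k i : ℕ) : upper g k (i + 1) ≤ g k i := by
  simp [upper]

theorem le_lower (g : ℕ → ℕ → ℕ) (k i : ℕ) : g k i ≤ lower g k i := le_max_left _ _

theorem le_lower_of_succ (g : ℕ → ℕ → ℕ) (k i : ℕ) : g (k + 2) (i + 1) ≤ lower g k i :=
  le_max_right _ _

theorem upper_toggleVal (j k : ℕ) (g : ℕ → ℕ → ℕ) : upper (toggleVal j k g) k = upper g k := by
  funext i
  simp [upper, toggleVal]

theorem lower_toggleVal (j k : ℕ) (g : ℕ → ℕ → ℕ) : lower (toggleVal j k g) k = lower g k := by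
  funext i
  simp [lower, toggleVal]

-- The minimum of `g k i` and `g (k + 2) (i + 1)` bounds from above at `i + 1`, and their maximum
-- bounds from below at `i`, so that the sum telescopes.
theorem sum_min_upper_add_min_lower (g : ℕ → ℕ → ℕ) (j k N : ℕ) :
    ∑ i ∈ Finset.range N, (min (upper g k i) j + min (lower g k i) j) + min (upper g k N) j =
      ∑ i ∈ Finset.range N, (min (g (k + 2) i) j + min (g k i) j) + min (g (k + 2) N) j := by
  induction N with
  | zero => simp [upper]
  | succ N ih =>
    have hN : min (lower g k N) j + min (upper g k (N + 1)) j =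
        min (g k N) j + min (g (k + 2) (N + 1)) j := by
      simp only [lower, upper, Nat.add_sub_cancel, Nat.succ_ne_zero, if_false]
      omega
    simp only [Finset.sum_range_succ]
    omega

namespace InterlacingChain

theorem le_upper (g : InterlacingChain n b t) (k i : ℕ) : g.val (k + 1) i ≤ upper g.val k i := by
  rw [upper]
  split_ifs with h
  · rw [← h]
    exact g.mono (k + 1) i
  · exact le_min (g.mono (k + 1) i) (g.inter_of_lt k (by omega))

theorem lower_le (g : InterlacingChain n b t) (k i : ℕ) : lower g.val k i ≤ g.val (k + 1) i :=
  max_le (g.mono k i) (g.inter (k + 1) i)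

theorem toggleVal_cases {j k : ℕ} (hf : ColAvoids j k g.val) (i : ℕ) :
    (j < g.val k i ∧ toggleVal j k g.val (k + 1) i = g.val (k + 1) i) ∨
    (g.val (k + 1) i ≤ j ∧ toggleVal j k g.val (k + 1) i + g.val (k + 1) i =
      min (upper g.val k i) j + lower g.val k i) := by
  have hup := g.le_upper k i
  have hlow := g.lower_le k i
  have hlow' := le_lower g.val k i
  rw [toggleVal_self]
  rcases hf i with h | h
  · left; omega
  · right; omega

theorem lower_le_toggleVal {j k : ℕ} (hf : ColAvoids j k g.val) (i : ℕ) :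
    lower g.val k i ≤ toggleVal j k g.val (k + 1) i := by
  have hup := g.le_upper k i
  have hlow := g.lower_le k i
  rcases toggleVal_cases hf i with h | h <;> omega

theorem toggleVal_le_upper {j k : ℕ} (hf : ColAvoids j k g.val) (i : ℕ) :
    toggleVal j k g.val (k + 1) i ≤ upper g.val k i := by
  have hup := g.le_upper k i
  have hlow := g.lower_le k i
  rcases toggleVal_cases hf i with h | h <;> omega

/-- The chain obtained by a Bender-Knuth involution on the columns before `j`. -/
def toggle (g : InterlacingChain n b t) (j k : ℕ) (hk : k + 1 < n) (hf : ColAvoids j k g.val) :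
    InterlacingChain n b t where
  val := toggleVal j k g.val
  base := by
    funext i
    rw [toggleVal_of_ne _ _ (by omega), g.base]
  top k' hk' := by
    funext i
    rw [toggleVal_of_ne _ _ (by omega), g.top k' hk']
  mono k' i := by
    by_cases h1 : k' = k + 1
    · subst h1
      rw [toggleVal_of_ne _ _ (show k + 1 + 1 ≠ k + 1 by omega)]
      exact (toggleVal_le_upper hf i).trans (upper_le g.val k i)
    · rw [toggleVal_of_ne _ _ h1]
      by_cases h2 : k' = k
      · subst h2
        exact (le_lower g.val k' i).trans (lower_le_toggleVal hf i)
      · rw [toggleVal_of_ne _ _ (show k' + 1 ≠ k + 1 by omega)]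
        exact g.mono k' i
  inter k' i := by
    by_cases h1 : k' = k + 1
    · subst h1
      rw [toggleVal_of_ne _ _ (show k + 1 + 1 ≠ k + 1 by omega)]
      exact (le_lower_of_succ g.val k i).trans (lower_le_toggleVal hf i)
    · rw [toggleVal_of_ne _ _ h1]
      by_cases h2 : k' = k
      · subst h2
        exact (toggleVal_le_upper hf (i + 1)).trans (upper_succ_le g.val k' i)
      · rw [toggleVal_of_ne _ _ (show k' + 1 ≠ k + 1 by omega)]
        exact g.inter k' i
  supp := g.supp

theorem toggleVal_toggleVal {j k : ℕ} (hf : ColAvoids j k g.val) :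
    toggleVal j k (toggleVal j k g.val) = g.val := by
  funext k' i
  by_cases h : k' = k + 1
  · subst h
    have hup := g.le_upper k i
    have hlow := g.lower_le k i
    have hlow' := le_lower g.val k i
    rw [toggleVal_self, upper_toggleVal, lower_toggleVal]
    rcases toggleVal_cases hf i with h | h <;> omega
  · rw [toggleVal_of_ne _ _ h, toggleVal_of_ne _ _ h]

theorem countFromCol_toggleVal {j k j' : ℕ} (hf : ColAvoids j k g.val) (hj : j ≤ j') (k' : ℕ) :
    countFromCol n (toggleVal j k g.val) j' k' = countFromCol n g.val j' k' := by
  have hmax (k' i : ℕ) : max (toggleVal j k g.val k' i) j' = max (g.val k' i) j' := by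
    by_cases h : k' = k + 1
    · subst h
      have hlow := g.lower_le k i
      rcases toggleVal_cases hf i with h | h <;> omega
    · rw [toggleVal_of_ne _ _ h]
  simp only [countFromCol, hmax]

theorem sum_min_toggleVal {j k : ℕ} (hf : ColAvoids j k g.val) :
    ∑ i ∈ Finset.range n, min (toggleVal j k g.val (k + 1) i) j +
      ∑ i ∈ Finset.range n, min (g.val (k + 1) i) j =
    ∑ i ∈ Finset.range n, min (g.val (k + 2) i) j + ∑ i ∈ Finset.range n, min (g.val k i) j := by
  have hrow (i : ℕ) : min (toggleVal j k g.val (k + 1) i) j + min (g.val (k + 1) i) j =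
      min (upper g.val k i) j + min (lower g.val k i) j := by
    have hup := g.le_upper k i
    have hlow := g.lower_le k i
    have hlow' := le_lower g.val k i
    rcases toggleVal_cases hf i with h | h <;> omega
  have htop : g.val (k + 2) n = 0 := g.val_eq_zero _ le_rfl
  have hupper : upper g.val k n = 0 := Nat.le_zero.1 ((upper_le g.val k n).trans htop.le)
  rw [← Finset.sum_add_distrib, ← Finset.sum_add_distrib, Finset.sum_congr rfl fun i _ => hrow i]
  simpa [htop, hupper] using sum_min_upper_add_min_lower g.val j k n

theorem chainWt_add_sum_min (g : InterlacingChain n b t) (j k : ℕ) :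
    chainWt n g.val k + ∑ i ∈ Finset.range n, min (g.val k i) j =
      countFromCol n g.val j k + ∑ i ∈ Finset.range n, min (g.val (k + 1) i) j := by
  rw [chainWt, countFromCol, ← Finset.sum_add_distrib, ← Finset.sum_add_distrib]
  refine Finset.sum_congr rfl fun i _ => ?_
  have := g.mono k i
  rw [mult]
  omega

theorem chainWt_toggle_of_ne {j k k' : ℕ} (hk : k + 1 < n) (hf : ColAvoids j k g.val)
    (h1 : k' ≠ k) (h2 : k' ≠ k + 1) :
    chainWt n (g.toggle j k hk hf).val k' = chainWt n g.val k' := by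
  refine Finset.sum_congr rfl fun i _ => ?_
  simp only [mult, toggle]
  rw [toggleVal_of_ne _ _ h2, toggleVal_of_ne _ _ (by omega)]

theorem chainWt_toggle_left {j k : ℕ} (hk : k + 1 < n) (hf : ColAvoids j k g.val) :
    chainWt n (g.toggle j k hk hf).val k + countFromCol n g.val j (k + 1) =
      countFromCol n g.val j k + chainWt n g.val (k + 1) := by
  have hk' := chainWt_add_sum_min (g.toggle j k hk hf) j k
  have hk1 := chainWt_add_sum_min g j (k + 1)
  have hmin := sum_min_toggleVal hf
  have hval (i : ℕ) : (g.toggle j k hk hf).val k i = g.val k i := toggleVal_of_ne _ _ (by omega)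
  have hcount := countFromCol_toggleVal hf (le_refl j) k
  simp only [hval] at hk'
  simp only [toggle] at hk' ⊢
  simp only [add_assoc, Nat.reduceAdd] at *
  omega

theorem chainWt_toggle_right {j k : ℕ} (hk : k + 1 < n) (hf : ColAvoids j k g.val) :
    chainWt n (g.toggle j k hk hf).val (k + 1) + countFromCol n g.val j k =
      countFromCol n g.val j (k + 1) + chainWt n g.val k := by
  have hsum (g' : InterlacingChain n b t) : chainWt n g'.val k + chainWt n g'.val (k + 1) =
      ∑ i ∈ Finset.range n, (g'.val (k + 1 + 1) i - g'.val k i) := by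
    rw [chainWt, chainWt, ← Finset.sum_add_distrib]
    refine Finset.sum_congr rfl fun i _ => ?_
    have h1 := g'.mono k i
    have h2 := g'.mono (k + 1) i
    rw [mult, mult]
    omega
  have hval (k' i : ℕ) (hne : k' ≠ k + 1) : (g.toggle j k hk hf).val k' i = g.val k' i :=
    toggleVal_of_ne _ _ hne
  have htotal := hsum (g.toggle j k hk hf)
  simp only [hval (k + 1 + 1) _ (by omega), hval k _ (by omega), ← hsum g] at htotal
  have hleft := chainWt_toggle_left hk hf
  omega

/-! ### The first violation of dominance -/

theorem countFromCol_eq_add_card (g : InterlacingChain n b t) (j k : ℕ) :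
    countFromCol n g.val j k = countFromCol n g.val (j + 1) k +
      ((Finset.range n).filter fun i => g.val k i ≤ j ∧ j < g.val (k + 1) i).card := by
  rw [countFromCol, countFromCol, Finset.card_filter, ← Finset.sum_add_distrib]
  refine Finset.sum_congr rfl fun i _ => ?_
  have := g.mono k i
  split_ifs with h <;> omega

theorem card_column_le_one (g : InterlacingChain n b t) (j k : ℕ) :
    ((Finset.range n).filter fun i => g.val k i ≤ j ∧ j < g.val (k + 1) i).card ≤ 1 := by
  simp only [Finset.card_le_one, Finset.mem_filter]
  rintro x ⟨-, hx⟩ y ⟨-, hy⟩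
  by_contra hne
  rcases Nat.lt_or_gt_of_ne hne with h | h <;> have := g.inter_of_lt k h <;> omega

end InterlacingChain

/-- Reading columns from the right, `j` is the first column at which dominance relative to `κ`
fails, and `k` is the first letter for which it fails there. -/
structure FirstViolation (n : ℕ) (κ : ℕ → ℕ) (g : ℕ → ℕ → ℕ) (j k : ℕ) : Prop where
  lt : κ k + countFromCol n g j k < κ (k + 1) + countFromCol n g j (k + 1)
  le_of_col : ∀ j', j < j' → ∀ k', κ (k' + 1) + countFromCol n g j' (k' + 1) ≤
    κ k' + countFromCol n g j' k'
  le_of_letter : ∀ k' < k, κ (k' + 1) + countFromCol n g j (k' + 1) ≤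
    κ k' + countFromCol n g j k'

theorem InterlacingChain.exists_firstViolation (hκ : Antitone κ)
    (h : ¬ IsColDominant n κ g.val) : ∃ j k, FirstViolation n κ g.val j k := by
  classical
  let Fails (j : ℕ) : Prop :=
    ∃ k, κ k + countFromCol n g.val j k < κ (k + 1) + countFromCol n g.val j (k + 1)
  obtain ⟨j₀, hj₀⟩ : ∃ j, Fails j := by
    simpa only [IsColDominant, not_forall, not_le] using h
  have hbound : ∀ j, Fails j → j ≤ t 0 := by
    rintro j ⟨k, hk⟩
    by_contra! hj
    have hzero : countFromCol n g.val j (k + 1) = 0 := by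
      refine Finset.sum_eq_zero fun i _ => ?_
      have h1 := g.antitone_val (k + 1 + 1) (Nat.zero_le i)
      have h2 := g.le_top (k + 1 + 1) 0
      omega
    have := hκ (Nat.le_add_right k 1)
    omega
  have hspec := Nat.findGreatest_spec (P := Fails) (hbound j₀ hj₀) hj₀
  refine ⟨Nat.findGreatest Fails (t 0), Nat.find hspec, Nat.find_spec hspec,
    fun j' hj' k' => ?_, fun k' hk' => not_lt.1 (Nat.find_min hspec hk')⟩
  by_contra! hlt
  exact Nat.findGreatest_is_greatest hj' (hbound j' ⟨k', hlt⟩) ⟨k', hlt⟩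

namespace FirstViolation

theorem not_isColDominant {g : ℕ → ℕ → ℕ} {j k : ℕ} (h : FirstViolation n κ g j k) :
    ¬ IsColDominant n κ g := fun hd => h.lt.not_ge (hd j k)

theorem unique {g : ℕ → ℕ → ℕ} {j k j' k' : ℕ}
    (h : FirstViolation n κ g j k) (h' : FirstViolation n κ g j' k') : j = j' ∧ k = k' := by
  obtain rfl : j = j' := by
    rcases lt_trichotomy j j' with hlt | heq | hlt
    · exact absurd (h.le_of_col _ hlt k') h'.lt.not_ge
    · exact heq
    · exact absurd (h'.le_of_col _ hlt k) h.lt.not_ge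
  refine ⟨rfl, ?_⟩
  rcases lt_trichotomy k k' with hlt | heq | hlt
  · exact absurd (h'.le_of_letter _ hlt) h.lt.not_ge
  · exact heq
  · exact absurd (h.le_of_letter _ hlt) h'.lt.not_ge

variable {j k : ℕ}

theorem count_eq (h : FirstViolation n κ g.val j k) :
    κ (k + 1) + countFromCol n g.val j (k + 1) = κ k + countFromCol n g.val j k + 1 := by
  have hlt := h.lt
  have hle := h.le_of_col (j + 1) j.lt_succ_self k
  have hk := g.countFromCol_eq_add_card j k
  have hk1 := g.countFromCol_eq_add_card j (k + 1)
  have hcard := g.card_column_le_one j (k + 1)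
  omega

theorem colAvoids (h : FirstViolation n κ g.val j k) : ColAvoids j k g.val := by
  have hlt := h.lt
  have hle := h.le_of_col (j + 1) j.lt_succ_self k
  have hk := g.countFromCol_eq_add_card j k
  have hk1 := g.countFromCol_eq_add_card j (k + 1)
  have hcard := g.card_column_le_one j (k + 1)
  have hempty :
      ((Finset.range n).filter fun i => g.val k i ≤ j ∧ j < g.val (k + 1) i).card = 0 := by
    omega
  rw [Finset.card_eq_zero, Finset.filter_eq_empty_iff] at hempty
  intro i
  by_cases hi : n ≤ i
  · simp [g.val_eq_zero _ hi]
  · have := hempty (Finset.mem_range.2 (not_le.1 hi))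
    omega

theorem letter_lt (h : FirstViolation n κ g.val j k) : k + 1 < n := by
  by_contra! hk
  have hlt := h.lt
  have hle := h.le_of_col (j + 1) j.lt_succ_self k
  have hcount := g.countFromCol_eq_add_card j k
  rw [g.countFromCol_eq_zero_of_letter _ hk] at hlt hle
  omega

theorem toggle (h : FirstViolation n κ g.val j k) :
    FirstViolation n κ (g.toggle j k h.letter_lt h.colAvoids).val j k where
  lt := by
    simpa only [InterlacingChain.toggle,
      InterlacingChain.countFromCol_toggleVal h.colAvoids le_rfl] using h.lt
  le_of_col j' hj' k' := by
    simpa only [InterlacingChain.toggle,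
      InterlacingChain.countFromCol_toggleVal h.colAvoids hj'.le] using h.le_of_col j' hj' k'
  le_of_letter k' hk' := by
    simpa only [InterlacingChain.toggle,
      InterlacingChain.countFromCol_toggleVal h.colAvoids le_rfl] using h.le_of_letter k' hk'

end FirstViolation

/-! ### Companion chains -/

/-- The companion array of `g`, in which the roles of rows and letters are exchanged: row `k` of
the companion contains as many letters `i` as row `i` of `g` contains letters `k`. It starts at
`κ`. -/
def companionVal (κ : ℕ → ℕ) (g : ℕ → ℕ → ℕ) (i k : ℕ) : ℕ :=
  κ k + ∑ i' ∈ Finset.range i, mult g i' k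

theorem mult_companionVal (κ : ℕ → ℕ) (g : ℕ → ℕ → ℕ) (i k : ℕ) :
    mult (companionVal κ g) k i = mult g i k := by
  rw [mult, companionVal, companionVal, Finset.sum_range_succ]
  omega

/-- The chains that are dominant relative to `κ` and whose weight leads from `κ` to `τ`. For `κ = 0`
they encode Littlewood-Richardson tableaux of weight `τ`. -/
abbrev DominantChain (n : ℕ) (b t κ τ : ℕ → ℕ) : Type :=
  {g : InterlacingChain n b t // IsRowDominant κ g.val ∧ ∀ k, κ k + chainWt n g.val k = τ k}

namespace DominantChain

variable {τ : ℕ → ℕ}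

theorem le (g : DominantChain n b t κ τ) (k : ℕ) : κ k ≤ τ k :=
  g.2.2 k ▸ Nat.le_add_right _ _

theorem eq_zero (g : DominantChain n b t κ τ) (hκ : ∀ k, n ≤ k → κ k = 0) {k : ℕ} (hk : n ≤ k) :
    τ k = 0 := by
  rw [← g.2.2, hκ k hk, g.1.chainWt_eq_zero hk]

/-- The companion of a dominant chain is a dominant chain for which the ends and the weight are
exchanged. -/
def companion (g : DominantChain n b t κ τ) (hτ : ∀ k, n ≤ k → τ k = 0) :
    DominantChain n κ τ b t where
  val :=
    { val := companionVal κ g.1.val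
      base := by funext k; simp [companionVal]
      top i hi := by
        funext k
        rw [companionVal, g.1.sum_mult_range hi, g.2.2]
      mono i k := by
        rw [companionVal, companionVal, Finset.sum_range_succ]
        omega
      inter i k := g.2.1 i k
      supp := hτ }
  property := by
    refine ⟨fun k i => ?_, fun i => ?_⟩
    · simp only [mult_companionVal, ← g.1.val_eq_add_sum]
      exact g.1.inter k i
    · simp only [chainWt, mult_companionVal, ← g.1.val_eq_add_sum, g.1.top n le_rfl]

theorem companionVal_companionVal (g : DominantChain n b t κ τ) :
    companionVal b (companionVal κ g.1.val) = g.1.val := by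
  funext k i
  simp only [companionVal.eq_1 b, mult_companionVal, ← g.1.val_eq_add_sum]

/-- Taking companions is an involution. -/
def companionEquiv (ht : ∀ i, n ≤ i → t i = 0) (hτ : ∀ k, n ≤ k → τ k = 0) :
    DominantChain n b t κ τ ≃ DominantChain n κ τ b t where
  toFun g := g.companion hτ
  invFun g := g.companion ht
  left_inv g := Subtype.ext (InterlacingChain.ext g.companionVal_companionVal)
  right_inv g := Subtype.ext (InterlacingChain.ext g.companionVal_companionVal)

end DominantChain

instance (n : ℕ) (b t : ℕ → ℕ) : Finite (InterlacingChain n b t) := by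
  let restrict (g : InterlacingChain n b t) (k i : Fin n) : Fin (t i + 1) :=
    ⟨g.val k i, Nat.lt_succ_of_le (g.le_top k i)⟩
  refine Finite.of_injective restrict fun g g' h => InterlacingChain.ext ?_
  funext k i
  by_cases hi : n ≤ i
  · rw [g.val_eq_zero _ hi, g'.val_eq_zero _ hi]
  by_cases hk : n ≤ k
  · rw [g.top k hk, g'.top k hk]
  have := congrFun (congrFun h ⟨k, not_le.1 hk⟩) ⟨i, not_le.1 hi⟩
  simpa [restrict] using this

/-! ### Alternants -/

section Alternants

open Equiv

variable {ι : Type*} [Fintype ι]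

/-- The monomial with exponents `α`. -/
noncomputable def expMonomial (α : ι → ℕ) : MvPowerSeries ι ℤ :=
  MvPowerSeries.monomial (Finsupp.equivFunOnFinite.symm α) 1

theorem expMonomial_mul (α β : ι → ℕ) :
    expMonomial α * expMonomial β = expMonomial (α + β) := by
  have h : Finsupp.equivFunOnFinite.symm α + Finsupp.equivFunOnFinite.symm β =
      Finsupp.equivFunOnFinite.symm (α + β) := Finsupp.ext fun _ => rfl
  rw [expMonomial, expMonomial, expMonomial, MvPowerSeries.monomial_mul_monomial, one_mul, h]

theorem coeff_expMonomial (α : ι → ℕ) (d : ι →₀ ℕ) [Decidable (⇑d = α)] :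
    MvPowerSeries.coeff d (expMonomial α) = if ⇑d = α then 1 else 0 := by
  classical
  rw [expMonomial, MvPowerSeries.coeff_monomial]
  exact if_congr (Equiv.eq_symm_apply _) rfl rfl

variable [DecidableEq ι]

/-- The alternant with exponents `α`: the antisymmetrization of the monomial with exponents
`α`. -/
noncomputable def alternant (α : ι → ℕ) : MvPowerSeries ι ℤ :=
  ∑ w : Perm ι, (Perm.sign w : ℤ) • expMonomial (α ∘ w)

theorem alternant_comp (α : ι → ℕ) (s : Perm ι) :
    alternant (α ∘ s) = (Perm.sign s : ℤ) • alternant α := by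
  rw [alternant, alternant, Finset.smul_sum]
  refine Fintype.sum_equiv (Equiv.mulLeft s) _ _ fun w => ?_
  rw [Equiv.coe_mulLeft, Perm.sign_mul, Perm.coe_mul, smul_smul, Function.comp_assoc]
  congr 1
  rcases Int.units_eq_one_or (Perm.sign s) with h | h <;> simp [h]

theorem alternant_comp_swap (α : ι → ℕ) {x y : ι} (h : x ≠ y) :
    alternant (α ∘ swap x y) = -alternant α := by
  simp [alternant_comp, Perm.sign_swap h]

theorem alternant_ne_zero {α : ι → ℕ} (hα : Function.Injective α) : alternant α ≠ 0 := by
  intro h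
  have hcoeff := congrArg (MvPowerSeries.coeff (Finsupp.equivFunOnFinite.symm α)) h
  rw [alternant, map_sum, Finset.sum_eq_single 1] at hcoeff
  · simp [coeff_expMonomial] at hcoeff
  · intro w _ hw
    rw [map_smul, coeff_expMonomial, if_neg, smul_zero]
    exact fun hc => hw (Equiv.ext fun x => hα (congrFun hc x).symm)
  · simp

/-- The staircase sequence `n - 1, …, 1, 0`. -/
def staircase (n : ℕ) (x : Fin n) : ℕ := n - 1 - x

theorem staircase_injective (n : ℕ) : Function.Injective (staircase n) := by
  intro x y h
  simp only [staircase] at h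
  ext
  omega

end Alternants

/-! ### Generating functions of chains -/

namespace InterlacingChain

open Equiv

noncomputable instance (n : ℕ) (b t : ℕ → ℕ) : Fintype (InterlacingChain n b t) :=
  Fintype.ofFinite _

/-- The weight of a chain, as exponents of `n` variables. -/
def wt (g : InterlacingChain n b t) (x : Fin n) : ℕ := chainWt n g.val x

/-- The generating function of the chains from `b` to `t` by weight: a skew Schur polynomial. -/
noncomputable def genSeries (n : ℕ) (b t : ℕ → ℕ) : MvPowerSeries (Fin n) ℤ :=
  ∑ g : InterlacingChain n b t, expMonomial g.wt

theorem colAvoids_top (g : InterlacingChain n b t) (k : ℕ) : ColAvoids (t 0) k g.val := fun i =>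
  Or.inr ((g.antitone_val (k + 1) (Nat.zero_le i)).trans (g.le_top (k + 1) 0))

theorem countFromCol_top (g : InterlacingChain n b t) (k : ℕ) :
    countFromCol n g.val (t 0) k = 0 :=
  Finset.sum_eq_zero fun i _ => by
    have h1 := g.antitone_val (k + 1) (Nat.zero_le i)
    have h2 := g.le_top (k + 1) 0
    omega

theorem wt_toggle_top (g : InterlacingChain n b t) {x y : Fin n} (hxy : (y : ℕ) = x + 1)
    (hx : (x : ℕ) + 1 < n) :
    (g.toggle (t 0) x hx (g.colAvoids_top x)).wt = g.wt ∘ swap x y := by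
  have hleft := chainWt_toggle_left hx (g.colAvoids_top x)
  have hright := chainWt_toggle_right hx (g.colAvoids_top x)
  rw [g.countFromCol_top, g.countFromCol_top] at hleft hright
  funext z
  simp only [wt, Function.comp]
  rcases eq_or_ne z x with rfl | hzx
  · rw [swap_apply_left, hxy]
    omega
  rcases eq_or_ne z y with rfl | hzy
  · rw [swap_apply_right, hxy]
    omega
  rw [swap_apply_of_ne_of_ne hzx hzy]
  exact chainWt_toggle_of_ne hx _ (fun hc => hzx (Fin.ext hc))
    fun hc => hzy (Fin.ext (hc.trans hxy.symm))

theorem sum_wt_comp {M : Type*} [AddCommMonoid M] (w : Perm (Fin n)) (F : (Fin n → ℕ) → M) :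
    ∑ g : InterlacingChain n b t, F (g.wt ∘ w) = ∑ g : InterlacingChain n b t, F g.wt := by
  obtain _ | n := n
  · simp [Subsingleton.elim w 1]
  have hw : w ∈ Submonoid.closure (Set.range fun i : Fin n => swap i.castSucc i.succ) := by
    rw [Perm.mclosure_swap_castSucc_succ]
    trivial
  induction hw using Submonoid.closure_induction generalizing F with
  | mem w hw =>
    obtain ⟨i, rfl⟩ := hw
    have hx : (i.castSucc : ℕ) + 1 < n + 1 := by simp
    have hinv : Function.Involutive fun g : InterlacingChain (n + 1) b t =>
        g.toggle (t 0) i.castSucc hx (g.colAvoids_top _) :=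
      fun g => InterlacingChain.ext (toggleVal_toggleVal (g.colAvoids_top _))
    refine Fintype.sum_equiv hinv.toPerm _ _ fun g => ?_
    exact congrArg F (g.wt_toggle_top (by simp) hx).symm
  | one => simp
  | mul x y _ _ hx hy => exact (hx fun α => F (α ∘ y)).trans (hy F)

theorem alternant_mul_genSeries (α : Fin n → ℕ) :
    alternant α * genSeries n b t = ∑ g : InterlacingChain n b t, alternant (α + g.wt) := by
  simp only [alternant]
  rw [Finset.sum_comm, Finset.sum_mul]
  refine Finset.sum_congr rfl fun w _ => ?_
  rw [genSeries, smul_mul_assoc, Finset.mul_sum, ← Finset.smul_sum,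
    ← sum_wt_comp w fun β => expMonomial (α ∘ w) * expMonomial β]
  simp only [expMonomial_mul]
  rfl

/-- The exponents `κ + ρ + wt g`, where `ρ` is the staircase, of the alternant that `g` contributes
to the product with the alternant `κ + ρ`. -/
def exponent (κ : ℕ → ℕ) (g : InterlacingChain n b t) : Fin n → ℕ :=
  (fun x : Fin n => κ x + staircase n x) + g.wt

theorem exponent_toggle {j k : ℕ} (h : FirstViolation n κ g.val j k) :
    exponent κ (g.toggle j k h.letter_lt h.colAvoids) =
      exponent κ g ∘ swap ⟨k, by have := h.letter_lt; omega⟩ ⟨k + 1, h.letter_lt⟩ := by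
  have hk := h.letter_lt
  have hcount := h.count_eq
  have hleft := chainWt_toggle_left hk h.colAvoids
  have hright := chainWt_toggle_right hk h.colAvoids
  funext z
  simp only [exponent, wt, Function.comp, Pi.add_apply, staircase]
  by_cases hz : z = ⟨k, by omega⟩
  · subst hz
    rw [swap_apply_left]
    dsimp only
    omega
  by_cases hz' : z = ⟨k + 1, hk⟩
  · subst hz'
    rw [swap_apply_right]
    dsimp only
    omega
  rw [swap_apply_of_ne_of_ne hz hz', chainWt_toggle_of_ne hk h.colAvoids
    (fun hc => hz (Fin.ext hc)) fun hc => hz' (Fin.ext hc)]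

theorem alternant_exponent_toggle {j k : ℕ} (h : FirstViolation n κ g.val j k) :
    alternant (exponent κ (g.toggle j k h.letter_lt h.colAvoids)) = -alternant (exponent κ g) := by
  rw [exponent_toggle h, alternant_comp_swap]
  simp

/-- The sign-reversing involution on non-dominant chains: a Bender-Knuth involution on the columns
before the first violation of dominance. -/
noncomputable def reflection (hκ : Antitone κ) (g : InterlacingChain n b t)
    (h : ¬IsColDominant n κ g.val) : InterlacingChain n b t :=
  have hv := (exists_firstViolation hκ h).choose_spec.choose_spec
  g.toggle _ _ hv.letter_lt hv.colAvoids

theorem reflection_eq_toggle (hκ : Antitone κ) {j k : ℕ} (h : FirstViolation n κ g.val j k) :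
    g.reflection hκ h.not_isColDominant = g.toggle j k h.letter_lt h.colAvoids := by
  have hall (j' k' : ℕ) (h' : FirstViolation n κ g.val j' k') :
      g.toggle j' k' h'.letter_lt h'.colAvoids = g.toggle j k h.letter_lt h.colAvoids := by
    obtain ⟨rfl, rfl⟩ := h'.unique h
    rfl
  exact hall _ _ (exists_firstViolation hκ h.not_isColDominant).choose_spec.choose_spec

theorem alternant_exponent_reflection (hκ : Antitone κ) (h : ¬IsColDominant n κ g.val) :
    alternant (exponent κ (g.reflection hκ h)) = -alternant (exponent κ g) := by
  obtain ⟨j, k, hv⟩ := exists_firstViolation hκ h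
  rw [reflection_eq_toggle hκ hv, alternant_exponent_toggle hv]

theorem not_isColDominant_reflection (hκ : Antitone κ) (h : ¬IsColDominant n κ g.val) :
    ¬IsColDominant n κ (g.reflection hκ h).val := by
  obtain ⟨j, k, hv⟩ := exists_firstViolation hκ h
  rw [reflection_eq_toggle hκ hv]
  exact hv.toggle.not_isColDominant

theorem reflection_reflection (hκ : Antitone κ) (h : ¬IsColDominant n κ g.val) :
    (g.reflection hκ h).reflection hκ (not_isColDominant_reflection hκ h) = g := by
  obtain ⟨j, k, hv⟩ := exists_firstViolation hκ h
  simp only [reflection_eq_toggle hκ hv, reflection_eq_toggle hκ hv.toggle]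
  exact InterlacingChain.ext (toggleVal_toggleVal hv.colAvoids)

theorem sum_alternant_not_isColDominant (hκ : Antitone κ)
    [DecidablePred fun g : InterlacingChain n b t => IsColDominant n κ g.val] :
    ∑ g : InterlacingChain n b t with ¬IsColDominant n κ g.val, alternant (exponent κ g) = 0 := by
  refine Finset.sum_involution
    (fun g hg => g.reflection hκ (Finset.mem_filter.1 hg).2) (fun g hg => ?_)
    (fun g hg hne hfix => ?_) (fun g hg => ?_) (fun g hg => ?_)
  · rw [alternant_exponent_reflection, add_neg_cancel]
  · have hneg := alternant_exponent_reflection hκ (Finset.mem_filter.1 hg).2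
    rw [hfix] at hneg
    exact hne (MvPowerSeries.ext fun d =>
      self_eq_neg.1 ((congrArg (MvPowerSeries.coeff d) hneg).trans (map_neg _ _)))
  · simpa using not_isColDominant_reflection hκ (Finset.mem_filter.1 hg).2
  · exact reflection_reflection hκ (Finset.mem_filter.1 hg).2

theorem alternant_mul_genSeries_eq_sum_isColDominant (hκ : Antitone κ)
    [DecidablePred fun g : InterlacingChain n b t => IsColDominant n κ g.val] :
    alternant (fun x : Fin n => κ x + staircase n x) * genSeries n b t =
      ∑ g : InterlacingChain n b t with IsColDominant n κ g.val, alternant (exponent κ g) := by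
  calc
    _ = ∑ g : InterlacingChain n b t, alternant (exponent κ g) := alternant_mul_genSeries _
    _ = _ := by
      rw [← Finset.sum_filter_add_sum_filter_not _ fun g => IsColDominant n κ g.val,
        sum_alternant_not_isColDominant hκ, add_zero]

end InterlacingChain

/-! ### Chains starting from the empty partition -/

theorem IsRowDominant.mult_eq_zero {g : ℕ → ℕ → ℕ} (h : IsRowDominant 0 g) {i k : ℕ}
    (hik : i < k) : mult g i k = 0 := by
  induction i using Nat.strong_induction_on generalizing k with
  | _ i ih =>
    obtain ⟨k, rfl⟩ := Nat.exists_eq_add_one_of_ne_zero (Nat.ne_zero_of_lt hik)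
    have hprev : ∑ i' ∈ Finset.range i, mult g i' k = 0 := by
      refine Finset.sum_eq_zero fun i' hi' => ?_
      rw [Finset.mem_range] at hi'
      exact ih i' hi' (by omega)
    have hdom := h i k
    rw [Finset.sum_range_succ, hprev] at hdom
    simp only [Pi.zero_apply] at hdom
    omega

namespace InterlacingChain

theorem val_eq_zero_of_le (g : InterlacingChain n 0 t) {k i : ℕ} (h : k ≤ i) : g.val k i = 0 := by
  induction k generalizing i with
  | zero => rw [g.base]; rfl
  | succ k ih =>
    obtain ⟨i, rfl⟩ := Nat.exists_eq_add_one_of_ne_zero (show i ≠ 0 by omega)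
    exact Nat.le_zero.1 ((g.inter k i).trans (ih (by omega)).le)

theorem val_eq_of_isRowDominant (g : InterlacingChain n 0 t) (h : IsRowDominant 0 g.val)
    (k i : ℕ) : g.val k i = if i < k then t i else 0 := by
  split_ifs with hik
  · have hconst (m : ℕ) : g.val (k + m) i = g.val k i := by
      induction m with
      | zero => rfl
      | succ m ih =>
        rw [← add_assoc, ← g.val_add_mult, h.mult_eq_zero (by omega), ih, add_zero]
    rw [← hconst n, g.top _ (Nat.le_add_left n k)]
  · exact g.val_eq_zero_of_le (not_lt.1 hik)

/-- The chain of the canonical tableau. -/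
def canonicalChain (ht : Antitone t) (hs : ∀ i, n ≤ i → t i = 0) : InterlacingChain n 0 t where
  val k i := if i < k then t i else 0
  base := by funext i; simp
  top k hk := by
    funext i
    split_ifs with h
    · rfl
    · exact (hs i (by omega)).symm
  mono k i := by split_ifs <;> omega
  inter k i := by
    have := ht (Nat.le_add_right i 1)
    split_ifs <;> omega
  supp := hs

theorem mult_canonicalChain (ht : Antitone t) (hs : ∀ i, n ≤ i → t i = 0) (i k : ℕ) :
    mult (canonicalChain ht hs).val i k = if i = k then t k else 0 := by
  simp only [mult, canonicalChain]
  by_cases h : i = k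
  · subst h; simp
  · split_ifs <;> omega

theorem isRowDominant_canonicalChain (ht : Antitone t) (hs : ∀ i, n ≤ i → t i = 0) :
    IsRowDominant 0 (canonicalChain ht hs).val := by
  intro i k
  simp only [mult_canonicalChain, Finset.sum_ite_eq', Finset.mem_range, Pi.zero_apply, zero_add]
  have := ht (Nat.le_add_right k 1)
  split_ifs <;> omega

theorem chainWt_canonicalChain (ht : Antitone t) (hs : ∀ i, n ≤ i → t i = 0) (k : ℕ) :
    chainWt n (canonicalChain ht hs).val k = t k := by
  simp only [chainWt, mult_canonicalChain, Finset.sum_ite_eq', Finset.mem_range]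
  split_ifs with h
  · rfl
  · exact (hs k (not_lt.1 h)).symm

theorem isColDominant_iff_eq_canonicalChain (ht : Antitone t) (hs : ∀ i, n ≤ i → t i = 0)
    (g : InterlacingChain n 0 t) : IsColDominant n 0 g.val ↔ g = canonicalChain ht hs := by
  rw [← isRowDominant_iff_isColDominant]
  refine ⟨fun h => InterlacingChain.ext ?_, ?_⟩
  · funext k i
    exact val_eq_of_isRowDominant g h k i
  · rintro rfl
    exact isRowDominant_canonicalChain ht hs

theorem alternant_staircase_mul_genSeries (ht : Antitone t) (hs : ∀ i, n ≤ i → t i = 0) :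
    alternant (staircase n) * genSeries n 0 t =
      alternant (fun x : Fin n => t x + staircase n x) := by
  classical
  have h := alternant_mul_genSeries_eq_sum_isColDominant (n := n) (b := 0) (t := t) (κ := 0)
    antitone_const
  have hunique : (Finset.univ.filter fun g : InterlacingChain n 0 t => IsColDominant n 0 g.val) =
      {canonicalChain ht hs} := by
    ext g
    simp [isColDominant_iff_eq_canonicalChain ht hs]
  simp only [hunique, Finset.sum_singleton, Pi.zero_apply, zero_add] at h
  refine h.trans (congrArg _ ?_)
  funext x
  simp [exponent, wt, chainWt_canonicalChain, add_comm]

end InterlacingChain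

/-! ### Tableaux as chains -/

theorem SkewShape.mem_cells_iff (χ : SkewShape) {i c : ℕ} :
    (i, c) ∈ χ.cells ↔ χ.inner.rowLen i ≤ c ∧ c < χ.outer.rowLen i := by
  rw [SkewShape.cells, Finset.mem_sdiff, YoungDiagram.mem_cells, YoungDiagram.mem_cells,
    YoungDiagram.mem_iff_lt_rowLen, YoungDiagram.mem_iff_lt_rowLen, not_lt, and_comm]

theorem rowLen_le_rowLen {μ ν : YoungDiagram} (h : μ ≤ ν) (i : ℕ) : μ.rowLen i ≤ ν.rowLen i :=
  le_of_forall_lt fun _ hc =>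
    YoungDiagram.mem_iff_lt_rowLen.1 (h (YoungDiagram.mem_iff_lt_rowLen.2 hc))

theorem rowLen_eq_zero {ν : YoungDiagram} {i : ℕ} (h : ν.colLen 0 ≤ i) : ν.rowLen i = 0 := by
  by_contra hpos
  have hmem : (i, 0) ∈ ν := YoungDiagram.mem_iff_lt_rowLen.2 (Nat.pos_of_ne_zero hpos)
  exact (YoungDiagram.mem_iff_lt_colLen.1 hmem).not_ge h

theorem antitone_rowLen (ν : YoungDiagram) : Antitone ν.rowLen :=
  fun _ _ h => ν.rowLen_anti _ _ h

theorem eq_of_rowLen_eq {ν ν' : YoungDiagram} (h : ∀ i, ν.rowLen i = ν'.rowLen i) : ν = ν' := by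
  ext ⟨i, j⟩
  rw [YoungDiagram.mem_cells, YoungDiagram.mem_cells, YoungDiagram.mem_iff_lt_rowLen,
    YoungDiagram.mem_iff_lt_rowLen, h]

theorem rowLen_bot : (⊥ : YoungDiagram).rowLen = 0 := by
  funext i
  by_contra h
  exact YoungDiagram.notMem_bot (i, 0) (YoungDiagram.mem_iff_lt_rowLen.2 (Nat.pos_of_ne_zero h))

namespace Tab

variable {χ : SkewShape} (T : Tab χ)

theorem exists_firstCol (k i : ℕ) :
    ∃ c, χ.inner.rowLen i ≤ c ∧ (χ.outer.rowLen i ≤ c ∨ k ≤ T.entry i c) :=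
  ⟨χ.outer.rowLen i, rowLen_le_rowLen χ.le i, Or.inl le_rfl⟩

open Classical in
/-- The first column of row `i` outside the inner shape where there is no entry less than `k`: the
encoding of a tableau by an interlacing chain. -/
noncomputable def firstCol (k i : ℕ) : ℕ := Nat.find (T.exists_firstCol k i)

theorem firstCol_spec (k i : ℕ) : χ.inner.rowLen i ≤ T.firstCol k i ∧
    (χ.outer.rowLen i ≤ T.firstCol k i ∨ k ≤ T.entry i (T.firstCol k i)) := by
  classical exact Nat.find_spec (T.exists_firstCol k i)

theorem firstCol_le {k i c : ℕ} (hin : χ.inner.rowLen i ≤ c)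
    (hc : χ.outer.rowLen i ≤ c ∨ k ≤ T.entry i c) : T.firstCol k i ≤ c := by
  classical exact Nat.find_min' (T.exists_firstCol k i) ⟨hin, hc⟩

theorem firstCol_le_outer (k i : ℕ) : T.firstCol k i ≤ χ.outer.rowLen i :=
  T.firstCol_le (rowLen_le_rowLen χ.le i) (Or.inl le_rfl)

theorem lt_firstCol_iff {k i c : ℕ} (h : (i, c) ∈ χ.cells) :
    c < T.firstCol k i ↔ T.entry i c < k := by
  have hc := χ.mem_cells_iff.1 h
  refine ⟨fun hlt => ?_, fun hlt => ?_⟩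
  · by_contra hge
    exact (T.firstCol_le hc.1 (Or.inr (not_lt.1 hge))).not_gt hlt
  · by_contra hge
    obtain ⟨hin, hout | hk⟩ := T.firstCol_spec k i
    · omega
    rcases (not_lt.1 hge).lt_or_eq with hlt' | heq
    · have := T.row_weak hlt' (χ.mem_cells_iff.2 ⟨hin, by omega⟩) h
      omega
    · rw [heq] at hk
      omega

theorem firstCol_mono (k i : ℕ) : T.firstCol k i ≤ T.firstCol (k + 1) i := by
  obtain ⟨hin, hk⟩ := T.firstCol_spec (k + 1) i
  exact T.firstCol_le hin (hk.imp_right fun h => by omega)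

theorem firstCol_inter (k i : ℕ) : T.firstCol (k + 1) (i + 1) ≤ T.firstCol k i := by
  by_contra hlt
  obtain ⟨hin, hk⟩ := T.firstCol_spec k i
  have hout := T.firstCol_le_outer (k + 1) (i + 1)
  have houter := antitone_rowLen χ.outer (Nat.le_add_right i 1)
  have hinner := antitone_rowLen χ.inner (Nat.le_add_right i 1)
  have hcell : (i, T.firstCol k i) ∈ χ.cells := χ.mem_cells_iff.2 ⟨hin, by omega⟩
  have hcell' : (i + 1, T.firstCol k i) ∈ χ.cells := χ.mem_cells_iff.2 ⟨by omega, by omega⟩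
  have hbelow := (T.lt_firstCol_iff hcell').1 (not_le.1 hlt)
  have hstrict := T.col_strict (Nat.lt_add_one i) hcell hcell'
  omega

theorem firstCol_zero (i : ℕ) : T.firstCol 0 i = χ.inner.rowLen i :=
  le_antisymm (T.firstCol_le le_rfl (Or.inr (Nat.zero_le _))) (T.firstCol_spec 0 i).1

theorem entry_eq_iff {i c k : ℕ} (h : (i, c) ∈ χ.cells) :
    T.entry i c = k ↔ T.firstCol k i ≤ c ∧ c < T.firstCol (k + 1) i := by
  rw [T.lt_firstCol_iff h, ← not_lt, T.lt_firstCol_iff h]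
  omega

theorem firstCol_injective : Function.Injective (firstCol : Tab χ → ℕ → ℕ → ℕ) := by
  intro T T' h
  ext i c
  by_cases hmem : (i, c) ∈ χ.cells
  · have hcols := (T.entry_eq_iff hmem).1 rfl
    rw [h] at hcols
    exact ((T'.entry_eq_iff hmem).2 hcols).symm
  · rw [T.zeros hmem, T'.zeros hmem]

/-! ### Counting letters -/

theorem card_filter_entry {n : ℕ} (hn : χ.outer.colLen 0 ≤ n) (k : ℕ) (Q : ℕ × ℕ → Prop)
    [DecidablePred Q] :
    (χ.cells.filter fun p => Q p ∧ T.entry p.1 p.2 = k).card =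
      ∑ i ∈ Finset.range n,
        ((Finset.Ico (T.firstCol k i) (T.firstCol (k + 1) i)).filter fun c => Q (i, c)).card := by
  rw [← Finset.card_sigma]
  refine Finset.card_nbij' (fun p => ⟨p.1, p.2⟩) (fun p => (p.1, p.2)) ?_ ?_
    (fun _ _ => rfl) fun _ _ => rfl
  · rintro ⟨i, c⟩ hp
    obtain ⟨hmem, hQ, hk⟩ := Finset.mem_filter.1 hp
    have hi : i < n := by
      by_contra hi
      have := χ.mem_cells_iff.1 hmem
      rw [rowLen_eq_zero (hn.trans (not_lt.1 hi))] at this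
      omega
    simp only [Finset.coe_sigma, Set.mem_sigma_iff, Finset.mem_coe, Finset.mem_range,
      Finset.mem_filter, Finset.mem_Ico]
    exact ⟨hi, (T.entry_eq_iff hmem).1 hk, hQ⟩
  · rintro ⟨i, c⟩ hp
    simp only [Finset.coe_sigma, Set.mem_sigma_iff, Finset.mem_coe, Finset.mem_filter,
      Finset.mem_Ico] at hp
    have hmem : (i, c) ∈ χ.cells := by
      have hin := (T.firstCol_spec k i).1
      have hout := T.firstCol_le_outer (k + 1) i
      exact χ.mem_cells_iff.2 ⟨by omega, by omega⟩
    exact Finset.mem_filter.2 ⟨hmem, hp.2.2, (T.entry_eq_iff hmem).2 hp.2.1⟩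

/-- The number of entries `k` in columns from `j` on. -/
def countFromCol (j k : ℕ) : ℕ :=
  (χ.cells.filter fun p => j ≤ p.2 ∧ T.entry p.1 p.2 = k).card

theorem countFromCol_eq {n : ℕ} (hn : χ.outer.colLen 0 ≤ n) (j k : ℕ) :
    T.countFromCol j k = LRRule.countFromCol n T.firstCol j k := by
  rw [countFromCol, T.card_filter_entry hn k fun p => j ≤ p.2, LRRule.countFromCol]
  refine Finset.sum_congr rfl fun i _ => ?_
  have := T.firstCol_mono k i
  rw [Finset.Ico_filter_le, Nat.card_Ico]
  omega

theorem wt_apply (k : ℕ) : T.wt k = (χ.cells.filter fun p => T.entry p.1 p.2 = k).card := by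
  simp only [wt, Finsupp.finsetSum_apply, Finset.card_filter, Finsupp.single_apply]

theorem wt_eq_countFromCol (k : ℕ) : T.wt k = T.countFromCol 0 k := by
  simp only [wt_apply, countFromCol, Nat.zero_le, true_and]

theorem wt_eq_chainWt {n : ℕ} (hn : χ.outer.colLen 0 ≤ n) (k : ℕ) :
    T.wt k = chainWt n T.firstCol k := by
  simp only [wt_eq_countFromCol, T.countFromCol_eq hn, LRRule.countFromCol, chainWt, mult,
    Nat.max_zero]

theorem prefixCount_eq {n r : ℕ} (hn : χ.outer.colLen 0 ≤ n) (hr : r < n) (c k : ℕ) :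
    T.prefixCount r c k = ∑ i ∈ Finset.range r, mult T.firstCol i k +
      (T.firstCol (k + 1) r - max (T.firstCol k r) c) := by
  rw [prefixCount, T.card_filter_entry hn k fun p => p.1 < r ∨ (p.1 = r ∧ c ≤ p.2),
    ← Finset.sum_subset (Finset.range_mono (Nat.succ_le_of_lt hr)), Finset.sum_range_succ]
  · congr 1
    · refine Finset.sum_congr rfl fun i hi => ?_
      simp only [Finset.mem_range.1 hi, true_or, Finset.filter_true, Nat.card_Ico, mult]
    · simp only [lt_irrefl, true_and, false_or, Finset.Ico_filter_le, Nat.card_Ico]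
  · intro i _ hi
    have hlt : r < i := by simpa using hi
    simp [hlt.not_gt, hlt.ne']

theorem isLR_iff_isRowDominant : T.IsLR ↔ IsRowDominant 0 T.firstCol := by
  have hcount (r c k : ℕ) :=
    T.prefixCount_eq (le_max_left (χ.outer.colLen 0) (r + 1))
      (Nat.lt_of_succ_le (le_max_right _ _)) c k
  simp only [IsLR, IsRowDominant, hcount, Finset.sum_range_succ, Pi.zero_apply, mult, zero_add]
  refine ⟨fun h i k => ?_, fun h r c k => ?_⟩
  · have := h i (T.firstCol (k + 1) i) k
    omega
  · have := h r k
    omega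

/-! ### The correspondence with chains -/

/-- All entries are less than `n`: the restriction of the variables to `X 0, …, X (n - 1)`. -/
def EntriesLT (n : ℕ) : Prop := ∀ i c, (i, c) ∈ χ.cells → T.entry i c < n

variable {T} in
theorem EntriesLT.mono {n m : ℕ} (h : T.EntriesLT n) (hm : n ≤ m) : T.EntriesLT m :=
  fun i c hc => (h i c hc).trans_le hm

theorem exists_entriesLT : ∃ n, T.EntriesLT n :=
  ⟨χ.cells.sup (fun p => T.entry p.1 p.2) + 1, fun _ _ h =>
    Nat.lt_succ_of_le (Finset.le_sup (f := fun p : ℕ × ℕ => T.entry p.1 p.2) h)⟩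

theorem entriesLT_iff_wt_eq_zero {n : ℕ} : T.EntriesLT n ↔ ∀ k, n ≤ k → T.wt k = 0 := by
  simp only [wt_apply, Finset.card_eq_zero, Finset.filter_eq_empty_iff]
  refine ⟨fun h k hk p hp he => ?_, fun h i c hp => ?_⟩
  · exact (h p.1 p.2 hp).not_ge (he ▸ hk)
  · by_contra hge
    exact h _ (not_lt.1 hge) hp rfl

/-- The interlacing chain of a tableau. -/
noncomputable def toChain {n : ℕ} (hn : χ.outer.colLen 0 ≤ n) (hT : T.EntriesLT n) :
    InterlacingChain n χ.inner.rowLen χ.outer.rowLen where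
  val := T.firstCol
  base := funext T.firstCol_zero
  top k hk := by
    funext i
    refine le_antisymm (T.firstCol_le_outer k i) ?_
    by_contra hlt
    obtain ⟨hin, hge⟩ := T.firstCol_spec k i
    have := hT i _ (χ.mem_cells_iff.2 ⟨hin, not_le.1 hlt⟩)
    omega
  mono := T.firstCol_mono
  inter := T.firstCol_inter
  supp _ hi := rowLen_eq_zero (hn.trans hi)

theorem isLR_iff_countFromCol : T.IsLR ↔ ∀ j k, T.countFromCol j (k + 1) ≤ T.countFromCol j k := by
  obtain ⟨m, hm⟩ := T.exists_entriesLT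
  have hn : χ.outer.colLen 0 ≤ max (χ.outer.colLen 0) m := le_max_left _ _
  have hdom := isRowDominant_iff_isColDominant (κ := 0)
    (g := T.toChain hn (hm.mono (le_max_right _ _)))
  simp only [IsColDominant, Pi.zero_apply, zero_add] at hdom
  simp only [isLR_iff_isRowDominant, T.countFromCol_eq hn]
  exact hdom

variable {n : ℕ} (g : InterlacingChain n χ.inner.rowLen χ.outer.rowLen)

theorem exists_lt_val {i c : ℕ} (h : (i, c) ∈ χ.cells) : ∃ k, c < g.val (k + 1) i := by
  refine ⟨n, ?_⟩
  rw [g.top (n + 1) (Nat.le_succ n)]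
  exact (χ.mem_cells_iff.1 h).2

open Classical in
/-- The entries of the tableau encoded by a chain. -/
noncomputable def entryOfChain (i c : ℕ) : ℕ :=
  if h : (i, c) ∈ χ.cells then Nat.find (exists_lt_val g h) else 0

theorem entryOfChain_lt_iff {i c : ℕ} (h : (i, c) ∈ χ.cells) (k : ℕ) :
    entryOfChain g i c < k ↔ c < g.val k i := by
  classical
  rw [entryOfChain, dif_pos h, Nat.find_lt_iff]
  refine ⟨fun ⟨m, hm, hlt⟩ => hlt.trans_le (g.monotone_val i hm), fun hlt => ?_⟩
  rcases k with _ | k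
  · rw [g.base] at hlt
    exact absurd (χ.mem_cells_iff.1 h).1 (not_le.2 hlt)
  · exact ⟨k, Nat.lt_succ_self k, hlt⟩

/-- The tableau encoded by a chain. -/
noncomputable def ofChain : Tab χ where
  entry := entryOfChain g
  row_weak := by
    intro i j₁ j₂ hj h₁ h₂
    rw [← Nat.lt_succ_iff, entryOfChain_lt_iff g h₁]
    exact hj.trans ((entryOfChain_lt_iff g h₂ _).1 (Nat.lt_succ_self _))
  col_strict := by
    intro i₁ i₂ j hi h₁ h₂
    rw [entryOfChain_lt_iff g h₁]
    exact ((entryOfChain_lt_iff g h₂ _).1 (Nat.lt_succ_self _)).trans_le (g.inter_of_lt _ hi)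
  zeros := by
    intro i j h
    rw [entryOfChain, dif_neg h]

theorem ofChain_entry_lt_iff {i c : ℕ} (h : (i, c) ∈ χ.cells) (k : ℕ) :
    (ofChain g).entry i c < k ↔ c < g.val k i :=
  entryOfChain_lt_iff g h k

theorem ofChain_entriesLT : (ofChain g).EntriesLT n := by
  intro i c h
  rw [ofChain_entry_lt_iff g h, g.top n le_rfl]
  exact (χ.mem_cells_iff.1 h).2

theorem firstCol_ofChain : (ofChain g).firstCol = g.val := by
  funext k i
  have hiff {c : ℕ} (hc : (i, c) ∈ χ.cells) : c < (ofChain g).firstCol k i ↔ c < g.val k i :=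
    ((ofChain g).lt_firstCol_iff hc).trans (ofChain_entry_lt_iff g hc k)
  have hbase : χ.inner.rowLen i ≤ g.val k i := by
    simpa only [g.base] using g.monotone_val i (Nat.zero_le k)
  have hin := ((ofChain g).firstCol_spec k i).1
  have hout := (ofChain g).firstCol_le_outer k i
  have htop := g.le_top k i
  rcases lt_trichotomy ((ofChain g).firstCol k i) (g.val k i) with hlt | heq | hlt
  · exact absurd ((hiff (χ.mem_cells_iff.2 ⟨hin, by omega⟩)).2 hlt) (lt_irrefl _)
  · exact heq
  · exact absurd ((hiff (χ.mem_cells_iff.2 ⟨hbase, by omega⟩)).1 hlt) (lt_irrefl _)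

/-- Tableaux with entries less than `n` correspond to interlacing chains. -/
noncomputable def chainEquiv (χ : SkewShape) {n : ℕ} (hn : χ.outer.colLen 0 ≤ n) :
    {T : Tab χ // T.EntriesLT n} ≃ InterlacingChain n χ.inner.rowLen χ.outer.rowLen where
  toFun T := T.1.toChain hn T.2
  invFun g := ⟨ofChain g, ofChain_entriesLT g⟩
  left_inv _ := Subtype.ext (firstCol_injective (firstCol_ofChain _))
  right_inv g := InterlacingChain.ext (firstCol_ofChain g)

end Tab

/-! ### Moves of a slide -/

/-- `f` is a semistandard filling of the squares of `lam` outside `mu`, except for the empty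
square `h`: the states of a slide. -/
structure IsPunctured (lam mu : YoungDiagram) (f : ℕ × ℕ → Option ℕ) (h : ℕ × ℕ) : Prop where
  mem : h ∈ lam
  notMem : h ∉ mu
  dom : ∀ p, (∃ a, f p = some a) ↔ p ∈ lam ∧ p ∉ mu ∧ p ≠ h
  row : ∀ {i j₁ j₂ a b : ℕ}, j₁ < j₂ → f (i, j₁) = some a → f (i, j₂) = some b → a ≤ b
  col : ∀ {i₁ i₂ j a b : ℕ}, i₁ < i₂ → f (i₁, j) = some a → f (i₂, j) = some b → a < b

/-- The number of squares in `B`, in columns from `j` on, filled with `k`. -/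
def fillingCount (B : Finset (ℕ × ℕ)) (f : ℕ × ℕ → Option ℕ) (j k : ℕ) : ℕ :=
  (B.filter fun p => j ≤ p.2 ∧ f p = some k).card

/-- The number of squares in `B`, in column `j`, filled with `k`. -/
def columnCount (B : Finset (ℕ × ℕ)) (f : ℕ × ℕ → Option ℕ) (j k : ℕ) : ℕ :=
  (B.filter fun p => p.2 = j ∧ f p = some k).card

/-- The lattice condition for the columns of a filling of `B`, read from right to left. Cuts
inside a column would add no condition, since columns are strict. -/
def IsColLattice (B : Finset (ℕ × ℕ)) (f : ℕ × ℕ → Option ℕ) : Prop :=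
  ∀ j k, fillingCount B f j (k + 1) ≤ fillingCount B f j k

/-- The filling obtained when the entry `b` moves from `q` to `h`. -/
def moveEntry (f : ℕ × ℕ → Option ℕ) (h q : ℕ × ℕ) (b : ℕ) : ℕ × ℕ → Option ℕ :=
  Function.update (Function.update f h (some b)) q none

theorem moveEntry_eq_some_iff {f : ℕ × ℕ → Option ℕ} {h q : ℕ × ℕ} {b : ℕ} (hq : q ≠ h)
    (p : ℕ × ℕ) (k : ℕ) : moveEntry f h q b p = some k ↔
      (p = h ∧ b = k) ∨ (p ≠ h ∧ p ≠ q ∧ f p = some k) := by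
  rw [moveEntry]
  by_cases hpq : p = q
  · subst hpq; simp [hq]
  · rw [Function.update_of_ne hpq]
    by_cases hph : p = h
    · subst hph; simp
    · rw [Function.update_of_ne hph]; simp [hpq, hph]

theorem fillingCount_eq_add (B : Finset (ℕ × ℕ)) (f : ℕ × ℕ → Option ℕ) (j k : ℕ) :
    fillingCount B f j k = fillingCount B f (j + 1) k + columnCount B f j k := by
  rw [fillingCount, fillingCount, columnCount, Finset.card_filter, Finset.card_filter,
    Finset.card_filter, ← Finset.sum_add_distrib]
  refine Finset.sum_congr rfl fun p _ => ?_
  by_cases h : f p = some k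
  · simp only [h, and_true]
    split_ifs <;> omega
  · simp [h]

theorem columnCount_eq_zero {B : Finset (ℕ × ℕ)} {f : ℕ × ℕ → Option ℕ} {j k : ℕ}
    (hk : ∀ i, f (i, j) ≠ some k) : columnCount B f j k = 0 := by
  rw [columnCount, Finset.card_eq_zero, Finset.filter_eq_empty_iff]
  rintro ⟨i, j'⟩ - ⟨rfl, h⟩
  exact hk i h

theorem fillingCount_moveEntry {B : Finset (ℕ × ℕ)} {f : ℕ × ℕ → Option ℕ} {h q : ℕ × ℕ} {b : ℕ}
    (hh : h ∈ B) (hq : q ∈ B) (hqh : q ≠ h) (fh : f h = none) (fq : f q = some b) (j k : ℕ) :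
    fillingCount B (moveEntry f h q b) j k + (if b = k ∧ j ≤ q.2 then 1 else 0) =
      fillingCount B f j k + (if b = k ∧ j ≤ h.2 then 1 else 0) := by
  have hsplit (f' : ℕ × ℕ → Option ℕ) : fillingCount B f' j k =
      (if j ≤ h.2 ∧ f' h = some k then 1 else 0) + ((if j ≤ q.2 ∧ f' q = some k then 1 else 0) +
        ∑ p ∈ (B.erase h).erase q, if j ≤ p.2 ∧ f' p = some k then 1 else 0) := by
    rw [fillingCount, Finset.card_filter, ← Finset.add_sum_erase B _ hh,
      ← Finset.add_sum_erase _ _ (Finset.mem_erase.2 ⟨hqh, hq⟩)]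
  have hrest : ∑ p ∈ (B.erase h).erase q,
        (if j ≤ p.2 ∧ moveEntry f h q b p = some k then 1 else 0) =
      ∑ p ∈ (B.erase h).erase q, (if j ≤ p.2 ∧ f p = some k then 1 else 0) := by
    refine Finset.sum_congr rfl fun p hp => ?_
    simp only [Finset.mem_erase] at hp
    simp [moveEntry_eq_some_iff hqh, hp.1, hp.2.1]
  rw [hsplit, hsplit, hrest]
  simp only [moveEntry_eq_some_iff hqh, fh, fq, Option.some.injEq, ne_eq, not_true_eq_false,
    false_and, and_false, or_false, true_and, hqh, if_false, reduceCtorEq, and_comm (a := b = k)]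
  omega

namespace IsPunctured

variable {lam mu : YoungDiagram} {f : ℕ × ℕ → Option ℕ} {h : ℕ × ℕ}

theorem mem_of_eq_some (H : IsPunctured lam mu f h) {p : ℕ × ℕ} {a : ℕ} (hp : f p = some a) :
    p ∈ lam ∧ p ∉ mu ∧ p ≠ h := (H.dom p).1 ⟨a, hp⟩

theorem hole_eq_none (H : IsPunctured lam mu f h) : f h = none :=
  Option.eq_none_iff_forall_ne_some.2 fun _ ha => (H.mem_of_eq_some ha).2.2 rfl

theorem exists_eq_some_of_between (H : IsPunctured lam mu f h) {p x q : ℕ × ℕ} (hp : p ∉ mu)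
    (hq : q ∈ lam) (hpx : p ≤ x) (hxq : x ≤ q) (hx : x ≠ h) : ∃ a, f x = some a :=
  (H.dom x).2 ⟨lam.isLowerSet hxq hq, fun hmem => hp (mu.isLowerSet hpx hmem), hx⟩

theorem lt_of_row_lt (H : IsPunctured lam mu f h) {i i' j j' a b : ℕ} (hi : i < i') (hj : j ≤ j')
    (ha : f (i, j) = some a) (hb : f (i', j') = some b) : a < b := by
  have hp := (H.mem_of_eq_some ha).2.1
  have hq := (H.mem_of_eq_some hb).1
  rcases hj.eq_or_lt with rfl | hj
  · exact H.col hi ha hb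
  by_cases hcorner : (i, j') = h
  · obtain ⟨c, hc⟩ := H.exists_eq_some_of_between (x := (i', j)) hp hq ⟨hi.le, le_rfl⟩
      ⟨le_rfl, hj.le⟩ (by rw [← hcorner]; simp [hi.ne'])
    exact (H.col hi ha hc).trans_le (H.row hj hc hb)
  · obtain ⟨c, hc⟩ := H.exists_eq_some_of_between (x := (i, j')) hp hq ⟨le_rfl, hj.le⟩
      ⟨hi.le, le_rfl⟩ hcorner
    exact (H.row hj ha hc).trans_lt (H.col hi hc hb)

theorem le_of_le (H : IsPunctured lam mu f h) {i i' j j' a b : ℕ} (hi : i ≤ i') (hj : j ≤ j')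
    (ha : f (i, j) = some a) (hb : f (i', j') = some b) : a ≤ b := by
  rcases hi.eq_or_lt with rfl | hi
  · rcases hj.eq_or_lt with rfl | hj
    · exact (Option.some.inj (ha.symm.trans hb)).le
    · exact H.row hj ha hb
  · exact (H.lt_of_row_lt hi hj ha hb).le

theorem one_le_columnCount (H : IsPunctured lam mu f h) {i j k : ℕ} (hk : f (i, j) = some k) :
    1 ≤ columnCount lam.cells f j k :=
  Finset.card_pos.2 ⟨(i, j), Finset.mem_filter.2 ⟨(H.mem_of_eq_some hk).1, rfl, hk⟩⟩

theorem columnCount_le_one (H : IsPunctured lam mu f h) (j k : ℕ) :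
    columnCount lam.cells f j k ≤ 1 := by
  rw [columnCount, Finset.card_le_one]
  rintro ⟨i, j'⟩ hx ⟨i', j''⟩ hy
  simp only [Finset.mem_filter] at hx hy
  obtain ⟨-, rfl, hx⟩ := hx
  obtain ⟨-, rfl, hy⟩ := hy
  rcases lt_trichotomy i i' with hlt | rfl | hlt
  · exact absurd (H.col hlt hx hy) (lt_irrefl _)
  · rfl
  · exact absurd (H.col hlt hy hx) (lt_irrefl _)

theorem dom_moveEntry {q : ℕ × ℕ} {b : ℕ} (H : IsPunctured lam mu f h) (hq : f q = some b)
    (p : ℕ × ℕ) : (∃ a, moveEntry f h q b p = some a) ↔ p ∈ lam ∧ p ∉ mu ∧ p ≠ q := by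
  have hqh := (H.mem_of_eq_some hq).2.2
  simp only [moveEntry_eq_some_iff hqh]
  constructor
  · rintro ⟨a, ⟨rfl, -⟩ | ⟨-, hpq, ha⟩⟩
    · exact ⟨H.mem, H.notMem, hqh.symm⟩
    · have hp := H.mem_of_eq_some ha
      exact ⟨hp.1, hp.2.1, hpq⟩
  · rintro ⟨hlam, hmu, hpq⟩
    by_cases hp : p = h
    · exact ⟨b, Or.inl ⟨hp, rfl⟩⟩
    · obtain ⟨a, ha⟩ := (H.dom p).2 ⟨hlam, hmu, hp⟩
      exact ⟨a, Or.inr ⟨hp, hpq, ha⟩⟩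

variable {i j : ℕ}

theorem up {b : ℕ} (H : IsPunctured lam mu f (i, j)) (hb : f (i + 1, j) = some b)
    (hr : ∀ r, f (i, j + 1) = some r → b ≤ r) :
    IsPunctured lam mu (moveEntry f (i, j) (i + 1, j) b) (i + 1, j) := by
  have hq := H.mem_of_eq_some hb
  refine ⟨hq.1, hq.2.1, H.dom_moveEntry hb, ?_, ?_⟩
  · intro x j₁ j₂ a c hj ha hc
    rw [moveEntry_eq_some_iff hq.2.2] at ha hc
    simp only [Prod.mk.injEq, ne_eq] at ha hc
    rcases ha with ⟨⟨rfl, rfl⟩, rfl⟩ | ⟨-, -, ha⟩ <;>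
      rcases hc with ⟨⟨hx, rfl⟩, rfl⟩ | ⟨-, -, hc⟩
    · exact le_rfl
    · obtain ⟨r, hr'⟩ := H.exists_eq_some_of_between (x := (x, j₁ + 1)) H.notMem
        (H.mem_of_eq_some hc).1 ⟨le_rfl, Nat.le_succ _⟩ ⟨le_rfl, hj⟩ (by simp)
      exact (hr r hr').trans (H.le_of_le le_rfl hj hr' hc)
    · exact (H.lt_of_row_lt (Nat.lt_succ_of_le hx.le) hj.le ha hb).le
    · exact H.row hj ha hc
  · intro i₁ i₂ y a c hi ha hc
    rw [moveEntry_eq_some_iff hq.2.2] at ha hc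
    simp only [Prod.mk.injEq, ne_eq] at ha hc
    rcases ha with ⟨⟨rfl, rfl⟩, rfl⟩ | ⟨-, -, ha⟩ <;>
      rcases hc with ⟨⟨rfl, hy⟩, rfl⟩ | ⟨-, hne, hc⟩
    · exact absurd hi (lt_irrefl _)
    · have : i₂ ≠ i₁ + 1 := fun h => hne ⟨h, rfl⟩
      exact H.col (show i₁ + 1 < i₂ by omega) hb hc
    · exact H.lt_of_row_lt (Nat.lt_succ_of_lt hi) hy.le ha hb
    · exact H.col hi ha hc

theorem left {r : ℕ} (H : IsPunctured lam mu f (i, j)) (hr : f (i, j + 1) = some r)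
    (hb : ∀ b, f (i + 1, j) = some b → r < b) :
    IsPunctured lam mu (moveEntry f (i, j) (i, j + 1) r) (i, j + 1) := by
  have hq := H.mem_of_eq_some hr
  refine ⟨hq.1, hq.2.1, H.dom_moveEntry hr, ?_, ?_⟩
  · intro x j₁ j₂ a c hj ha hc
    rw [moveEntry_eq_some_iff hq.2.2] at ha hc
    simp only [Prod.mk.injEq, ne_eq] at ha hc
    rcases ha with ⟨⟨rfl, rfl⟩, rfl⟩ | ⟨-, -, ha⟩ <;>
      rcases hc with ⟨⟨hx, rfl⟩, rfl⟩ | ⟨-, hne, hc⟩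
    · exact le_rfl
    · have : j₂ ≠ j₁ + 1 := fun h => hne ⟨rfl, h⟩
      exact H.row (show j₁ + 1 < j₂ by omega) hr hc
    · exact H.le_of_le hx.le (Nat.le_succ_of_le hj.le) ha hr
    · exact H.row hj ha hc
  · intro i₁ i₂ y a c hi ha hc
    rw [moveEntry_eq_some_iff hq.2.2] at ha hc
    simp only [Prod.mk.injEq, ne_eq] at ha hc
    rcases ha with ⟨⟨rfl, rfl⟩, rfl⟩ | ⟨-, -, ha⟩ <;>
      rcases hc with ⟨⟨rfl, hy⟩, rfl⟩ | ⟨-, -, hc⟩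
    · exact absurd hi (lt_irrefl _)
    · obtain ⟨b, hb'⟩ := H.exists_eq_some_of_between (x := (i₁ + 1, y)) H.notMem
        (H.mem_of_eq_some hc).1 ⟨Nat.le_succ _, le_rfl⟩ ⟨hi, le_rfl⟩ (by simp)
      exact (hb b hb').trans_le (H.le_of_le hi le_rfl hb' hc)
    · exact H.lt_of_row_lt hi (Nat.le_succ_of_le hy.le) ha hr
    · exact H.col hi ha hc

/-! ### Invariance of the column lattice condition -/

theorem fillingCount_up {b : ℕ} (H : IsPunctured lam mu f (i, j)) (hb : f (i + 1, j) = some b)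
    (j' k : ℕ) : fillingCount lam.cells (moveEntry f (i, j) (i + 1, j) b) j' k =
      fillingCount lam.cells f j' k := by
  have hq := H.mem_of_eq_some hb
  simpa using fillingCount_moveEntry (B := lam.cells) H.mem hq.1 hq.2.2 H.hole_eq_none hb j' k

theorem fillingCount_left {r : ℕ} (H : IsPunctured lam mu f (i, j)) (hr : f (i, j + 1) = some r)
    (j' k : ℕ) :
    fillingCount lam.cells (moveEntry f (i, j) (i, j + 1) r) j' k +
      (if r = k ∧ j' = j + 1 then 1 else 0) = fillingCount lam.cells f j' k := by
  have hq := H.mem_of_eq_some hr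
  have hmove := fillingCount_moveEntry (B := lam.cells) H.mem hq.1 hq.2.2 H.hole_eq_none hr j' k
  dsimp only at hmove
  by_cases h : r = k
  · simp only [h, true_and] at hmove ⊢
    split_ifs at hmove ⊢ <;> omega
  · simpa [h] using hmove

theorem exists_right_lt {r x a : ℕ} (H : IsPunctured lam mu f (i, j))
    (hr : f (i, j + 1) = some r) (hb : ∀ b, f (i + 1, j) = some b → r < b)
    (ha : f (x, j) = some a) (har : a ≤ r) : ∃ y, f (x, j + 1) = some y ∧ a ≤ y ∧ y < r := by
  have hx := H.mem_of_eq_some ha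
  obtain hlt | rfl | hgt := lt_trichotomy x i
  · obtain ⟨y, hy⟩ := H.exists_eq_some_of_between (x := (x, j + 1)) hx.2.1
      (H.mem_of_eq_some hr).1 ⟨le_rfl, Nat.le_succ _⟩ ⟨hlt.le, le_rfl⟩ (by simp)
    exact ⟨y, hy, H.row (Nat.lt_succ_self j) ha hy, H.col hlt hy hr⟩
  · exact absurd rfl hx.2.2
  · obtain ⟨b, hb'⟩ := H.exists_eq_some_of_between (x := (i + 1, j)) H.notMem hx.1
      ⟨Nat.le_succ _, le_rfl⟩ ⟨hgt, le_rfl⟩ (by simp)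
    have := hb b hb'
    have := H.le_of_le hgt le_rfl hb' ha
    omega

theorem left_eq_succ {r x : ℕ} (H : IsPunctured lam mu f (i, j)) (hr : f (i, j + 1) = some r)
    (hb : ∀ b, f (i + 1, j) = some b → r < b) (hx : f (x, j + 1) = some (r + 1)) :
    f (x, j) = some (r + 1) := by
  have hix : i < x := by
    by_contra hle
    have := H.le_of_le (not_lt.1 hle) le_rfl hx hr
    omega
  have hmem := (H.mem_of_eq_some hx).1
  obtain ⟨b, hb'⟩ := H.exists_eq_some_of_between (x := (i + 1, j)) H.notMem hmem
    ⟨Nat.le_succ _, le_rfl⟩ ⟨hix, Nat.le_succ _⟩ (by simp)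
  obtain ⟨c, hc⟩ := H.exists_eq_some_of_between (x := (x, j)) H.notMem hmem
    ⟨hix.le, le_rfl⟩ ⟨le_rfl, Nat.le_succ _⟩ (by simp [hix.ne'])
  have := hb b hb'
  have := H.le_of_le hix le_rfl hb' hc
  have := H.row (Nat.lt_succ_self j) hc hx
  rw [hc, show c = r + 1 by omega]

/-- If column `j + 1` contains `r + 1`, then column `j` contains `r + 1` but not `r`, and the strict
inequality is inherited from the cut before column `j`; otherwise it is inherited from the cut
after column `j + 1`. -/
theorem fillingCount_succ_lt {r : ℕ} (H : IsPunctured lam mu f (i, j))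
    (hr : f (i, j + 1) = some r) (hb : ∀ b, f (i + 1, j) = some b → r < b)
    (hf : IsColLattice lam.cells f) :
    fillingCount lam.cells f (j + 1) (r + 1) < fillingCount lam.cells f (j + 1) r := by
  by_cases hex : ∃ x, f (x, j + 1) = some (r + 1)
  · obtain ⟨x, hx⟩ := hex
    have hcol := H.one_le_columnCount (H.left_eq_succ hr hb hx)
    have hcol' : columnCount lam.cells f j r = 0 := by
      refine columnCount_eq_zero fun x hx => ?_
      obtain ⟨y, -, hle, hlt⟩ := H.exists_right_lt hr hb hx le_rfl
      omega
    have hcut := hf j r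
    rw [fillingCount_eq_add _ _ j r, fillingCount_eq_add _ _ j (r + 1)] at hcut
    omega
  · have hcol := H.one_le_columnCount hr
    have hcol' : columnCount lam.cells f (j + 1) (r + 1) = 0 :=
      columnCount_eq_zero fun x hx => hex ⟨x, hx⟩
    have hcut := hf (j + 1 + 1) r
    rw [fillingCount_eq_add _ _ (j + 1) r, fillingCount_eq_add _ _ (j + 1) (r + 1)]
    omega

theorem fillingCount_succ_le {k : ℕ} (H : IsPunctured lam mu f (i, j))
    (hr : f (i, j + 1) = some (k + 1)) (hb : ∀ b, f (i + 1, j) = some b → k + 1 < b)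
    (hf : IsColLattice lam.cells (moveEntry f (i, j) (i, j + 1) (k + 1))) :
    fillingCount lam.cells f (j + 1) (k + 1) ≤ fillingCount lam.cells f (j + 1) k := by
  have hcount := H.fillingCount_left hr
  by_cases hex : ∃ x, f (x, j + 1) = some k
  · obtain ⟨x, hx⟩ := hex
    have hcol := H.one_le_columnCount hx
    have hcol' := H.columnCount_le_one (j + 1) (k + 1)
    have hcut := hf (j + 1 + 1) k
    have hk := hcount (j + 1 + 1) k
    have hk' := hcount (j + 1 + 1) (k + 1)
    rw [if_neg (by omega)] at hk hk'
    rw [fillingCount_eq_add _ _ (j + 1) k, fillingCount_eq_add _ _ (j + 1) (k + 1)]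
    omega
  · have hmove := moveEntry_eq_some_iff (f := f) (b := k + 1) (H.mem_of_eq_some hr).2.2
    have hcol := (H.left hr hb).one_le_columnCount ((hmove (i, j) (k + 1)).2 (Or.inl ⟨rfl, rfl⟩))
    have hcol' : columnCount lam.cells (moveEntry f (i, j) (i, j + 1) (k + 1)) j k = 0 := by
      refine columnCount_eq_zero fun x hx => ?_
      rcases (hmove (x, j) k).1 hx with ⟨-, hk⟩ | ⟨-, -, hk⟩
      · omega
      · obtain ⟨y, hy, hle, hlt⟩ := H.exists_right_lt hr hb hk (Nat.le_succ k)
        exact hex ⟨x, by rw [hy, show y = k by omega]⟩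
    have hcut := hf j k
    rw [fillingCount_eq_add _ _ j k, fillingCount_eq_add _ _ j (k + 1)] at hcut
    have hk := hcount (j + 1) k
    have hk' := hcount (j + 1) (k + 1)
    rw [if_neg (by omega)] at hk
    rw [if_pos ⟨rfl, rfl⟩] at hk'
    omega

/-- The only count that changes is that of `r` at the cut `j + 1`. -/
theorem isColLattice_left_iff {r : ℕ} (H : IsPunctured lam mu f (i, j))
    (hr : f (i, j + 1) = some r) (hb : ∀ b, f (i + 1, j) = some b → r < b) :
    IsColLattice lam.cells (moveEntry f (i, j) (i, j + 1) r) ↔ IsColLattice lam.cells f := by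
  have hcount := H.fillingCount_left hr
  refine ⟨fun hf j' k => ?_, fun hf j' k => ?_⟩
  · by_cases hcut : r = k + 1 ∧ j' = j + 1
    · obtain ⟨rfl, rfl⟩ := hcut
      exact H.fillingCount_succ_le hr hb hf
    · have hk := hcount j' k
      have hk' := hcount j' (k + 1)
      rw [if_neg hcut] at hk'
      have := hf j' k
      omega
  · have hk := hcount j' k
    have hk' := hcount j' (k + 1)
    by_cases hcut : r = k ∧ j' = j + 1
    · have hlt := H.fillingCount_succ_lt hr hb hf
      rw [if_pos hcut] at hk
      obtain ⟨rfl, rfl⟩ := hcut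
      omega
    · rw [if_neg hcut] at hk
      have := hf j' k
      omega

/-! ### Sequences of moves -/

variable {A B : (ℕ × ℕ → Option ℕ) × (ℕ × ℕ)}

theorem of_slideStep (H : IsPunctured lam mu A.1 A.2) (hs : SlideStep A B) :
    IsPunctured lam mu B.1 B.2 := by
  cases hs with
  | up f i j b hb hr => exact H.up hb hr
  | left f i j r hr hb => exact H.left hr hb

theorem isColLattice_iff_of_slideStep (H : IsPunctured lam mu A.1 A.2) (hs : SlideStep A B) :
    IsColLattice lam.cells B.1 ↔ IsColLattice lam.cells A.1 := by
  cases hs with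
  | up f i j b hb hr =>
    refine forall₂_congr fun j' k => ?_
    rw [← moveEntry, H.fillingCount_up hb, H.fillingCount_up hb]
  | left f i j r hr hb => exact H.isColLattice_left_iff hr hb

theorem fillingCount_zero_of_slideStep (H : IsPunctured lam mu A.1 A.2) (hs : SlideStep A B)
    (k : ℕ) : fillingCount lam.cells B.1 0 k = fillingCount lam.cells A.1 0 k := by
  cases hs with
  | up f i j b hb hr => exact H.fillingCount_up hb 0 k
  | left f i j r hr hb =>
    have hcount := H.fillingCount_left hr 0 k
    rwa [if_neg (by omega)] at hcount

theorem of_slideSteps (H : IsPunctured lam mu A.1 A.2)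
    (hs : Relation.ReflTransGen SlideStep A B) : IsPunctured lam mu B.1 B.2 := by
  induction hs with
  | refl => exact H
  | tail _ hs ih => exact ih.of_slideStep hs

theorem isColLattice_iff_of_slideSteps (H : IsPunctured lam mu A.1 A.2)
    (hs : Relation.ReflTransGen SlideStep A B) :
    IsColLattice lam.cells B.1 ↔ IsColLattice lam.cells A.1 := by
  induction hs with
  | refl => exact Iff.rfl
  | tail hs h ih => exact ((H.of_slideSteps hs).isColLattice_iff_of_slideStep h).trans ih

theorem fillingCount_zero_of_slideSteps (H : IsPunctured lam mu A.1 A.2)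
    (hs : Relation.ReflTransGen SlideStep A B) (k : ℕ) :
    fillingCount lam.cells B.1 0 k = fillingCount lam.cells A.1 0 k := by
  induction hs with
  | refl => rfl
  | tail hs h ih => exact ((H.of_slideSteps hs).fillingCount_zero_of_slideStep h k).trans ih

end IsPunctured

theorem SlideStep.hole_add {A B : (ℕ × ℕ → Option ℕ) × (ℕ × ℕ)} (hs : SlideStep A B) :
    B.2.1 + B.2.2 = A.2.1 + A.2.2 + 1 := by
  cases hs <;> dsimp only <;> omega

theorem exists_slideStep {f : ℕ × ℕ → Option ℕ} {i j : ℕ}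
    (h : ¬(f (i + 1, j) = none ∧ f (i, j + 1) = none)) : ∃ B, SlideStep (f, (i, j)) B := by
  by_cases hup : ∃ b, f (i + 1, j) = some b ∧ ∀ r, f (i, j + 1) = some r → b ≤ r
  · obtain ⟨b, hb, hr⟩ := hup
    exact ⟨_, .up f i j b hb hr⟩
  push Not at hup
  rcases hr : f (i, j + 1) with _ | r
  · obtain ⟨b, hb⟩ := Option.ne_none_iff_exists'.1 fun hb => h ⟨hb, hr⟩
    obtain ⟨r, hr', -⟩ := hup b hb
    exact absurd (hr.symm.trans hr') (by simp)
  · refine ⟨_, .left f i j r hr fun b hb => ?_⟩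
    obtain ⟨r', hr', hlt⟩ := hup b hb
    rw [hr] at hr'
    exact Option.some.inj hr' ▸ hlt

theorem IsPunctured.exists_terminal {lam mu : YoungDiagram}
    {A : (ℕ × ℕ → Option ℕ) × (ℕ × ℕ)} (H : IsPunctured lam mu A.1 A.2) :
    ∃ B, Relation.ReflTransGen SlideStep A B ∧
      B.1 (B.2.1 + 1, B.2.2) = none ∧ B.1 (B.2.1, B.2.2 + 1) = none := by
  induction hN : lam.cells.sup (fun p => p.1 + p.2) - (A.2.1 + A.2.2) using
    Nat.strong_induction_on generalizing A with
  | _ N ih =>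
    by_cases hA : A.1 (A.2.1 + 1, A.2.2) = none ∧ A.1 (A.2.1, A.2.2 + 1) = none
    · exact ⟨A, .refl, hA⟩
    obtain ⟨B, hs : SlideStep A B⟩ := exists_slideStep hA
    have hB := H.of_slideStep hs
    have hle : B.2.1 + B.2.2 ≤ lam.cells.sup (fun p => p.1 + p.2) :=
      Finset.le_sup (f := fun p : ℕ × ℕ => p.1 + p.2) hB.mem
    have hadd := hs.hole_add
    obtain ⟨C, hC, hterm⟩ := ih _ (by omega) hB rfl
    exact ⟨C, hC.head hs, hterm⟩

/-! ### Slides of tableaux -/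

/-- The Young diagram obtained by removing the corner `s`. -/
def eraseCorner (ν : YoungDiagram) (s : ℕ × ℕ) (hdown : (s.1 + 1, s.2) ∉ ν)
    (hright : (s.1, s.2 + 1) ∉ ν) : YoungDiagram where
  cells := ν.cells.erase s
  isLowerSet := by
    intro p q hqp hp
    simp only [Finset.mem_coe, Finset.mem_erase, YoungDiagram.mem_cells] at hp ⊢
    refine ⟨?_, ν.isLowerSet hqp hp.2⟩
    rintro rfl
    rcases Prod.lt_iff.1 (hqp.lt_of_ne hp.1.symm) with hlt | hlt
    · exact hdown (ν.up_left_mem hlt.1 hlt.2 hp.2)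
    · exact hright (ν.up_left_mem hlt.1 hlt.2 hp.2)

theorem exists_corner {ν : YoungDiagram} (h : ν.cells.Nonempty) :
    ∃ s ∈ ν.cells, (s.1 + 1, s.2) ∉ ν ∧ (s.1, s.2 + 1) ∉ ν := by
  obtain ⟨s, hs, hmax⟩ := ν.cells.exists_max_image (fun p => p.1 + p.2) h
  refine ⟨s, hs, fun hdown => ?_, fun hright => ?_⟩
  · have := hmax _ hdown
    dsimp only at this
    omega
  · have := hmax _ hright
    dsimp only at this
    omega

namespace Tab

variable {χ : SkewShape} (T : Tab χ)

theorem filling_eq_some_iff (p : ℕ × ℕ) (k : ℕ) :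
    T.filling p = some k ↔ p ∈ χ.cells ∧ T.entry p.1 p.2 = k := by
  rw [filling]
  split_ifs with h <;> simp [h]

theorem fillingCount_filling {B : Finset (ℕ × ℕ)} (hB : χ.cells ⊆ B) (j k : ℕ) :
    fillingCount B T.filling j k = T.countFromCol j k := by
  rw [fillingCount, countFromCol]
  congr 1
  ext p
  simp only [Finset.mem_filter, filling_eq_some_iff]
  exact ⟨fun ⟨_, hj, hp, hk⟩ => ⟨hp, hj, hk⟩, fun ⟨hp, hj, hk⟩ => ⟨hB hp, hj, hp, hk⟩⟩

theorem isLR_iff_isColLattice {B : Finset (ℕ × ℕ)} (hB : χ.cells ⊆ B) :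
    T.IsLR ↔ IsColLattice B T.filling := by
  simp only [T.isLR_iff_countFromCol, IsColLattice, T.fillingCount_filling hB]

theorem isPunctured_filling {mu : YoungDiagram} {s : ℕ × ℕ} (hs : s ∈ χ.inner.cells)
    (hmu : mu.cells = χ.inner.cells.erase s) : IsPunctured χ.outer mu T.filling s := by
  have hmem (p : ℕ × ℕ) : p ∈ mu ↔ p ≠ s ∧ p ∈ χ.inner := by
    rw [← YoungDiagram.mem_cells, hmu, Finset.mem_erase, YoungDiagram.mem_cells]
  refine ⟨χ.le hs, by simp [hmem], fun p => ?_, ?_, ?_⟩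
  · simp only [filling_eq_some_iff, exists_and_left, exists_eq', and_true, SkewShape.cells,
      Finset.mem_sdiff, YoungDiagram.mem_cells, hmem, not_and]
    exact ⟨fun ⟨hout, hin⟩ => ⟨hout, fun _ => hin, fun h => hin (h ▸ hs)⟩,
      fun ⟨hout, hin, hne⟩ => ⟨hout, hin hne⟩⟩
  · intro i j₁ j₂ a b hj ha hb
    rw [filling_eq_some_iff] at ha hb
    rw [← ha.2, ← hb.2]
    exact T.row_weak hj ha.1 hb.1
  · intro i₁ i₂ j a b hi ha hb
    rw [filling_eq_some_iff] at ha hb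
    rw [← ha.2, ← hb.2]
    exact T.col_strict hi ha.1 hb.1

end Tab

section Invariance

variable {χ χ' : SkewShape} {T : Tab χ} {T' : Tab χ'}

theorem InwardSlide.isLR_iff (h : InwardSlide T T') : T.IsLR ↔ T'.IsLR := by
  obtain ⟨s, t, hs, hmu, -, hlam, hsteps, -, -⟩ := h
  rw [T.isLR_iff_isColLattice (B := χ.outer.cells) Finset.sdiff_subset,
    T'.isLR_iff_isColLattice (Finset.sdiff_subset.trans (hlam ▸ Finset.erase_subset _ _))]
  exact ((T.isPunctured_filling hs hmu).isColLattice_iff_of_slideSteps hsteps).symm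

theorem InwardSlide.wt_eq (h : InwardSlide T T') : T'.wt = T.wt := by
  obtain ⟨s, t, hs, hmu, -, hlam, hsteps, -, -⟩ := h
  ext k
  rw [T.wt_eq_countFromCol, T'.wt_eq_countFromCol,
    ← T.fillingCount_filling (B := χ.outer.cells) Finset.sdiff_subset,
    ← T'.fillingCount_filling (Finset.sdiff_subset.trans (hlam ▸ Finset.erase_subset _ _))]
  exact (T.isPunctured_filling hs hmu).fillingCount_zero_of_slideSteps hsteps k

theorem SlidesTo.invariant {α : Type*} (φ : ∀ {ψ : SkewShape}, Tab ψ → α)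
    (hφ : ∀ {ψ ψ' : SkewShape} {S : Tab ψ} {S' : Tab ψ'}, InwardSlide S S' → φ S' = φ S)
    (h : SlidesTo T T') : φ T' = φ T := by
  refine Relation.ReflTransGen.rec (motive := fun B _ => φ B.2 = φ T) rfl ?_ h
  exact fun _ hslide ih => (hφ hslide).trans ih

theorem SlidesTo.isLR_iff (h : SlidesTo T T') : T.IsLR ↔ T'.IsLR :=
  (h.invariant Tab.IsLR fun hslide => propext hslide.isLR_iff.symm).symm.to_iff

theorem SlidesTo.wt_eq (h : SlidesTo T T') : T'.wt = T.wt :=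
  h.invariant Tab.wt InwardSlide.wt_eq

end Invariance

/-! ### Rectification -/

namespace IsPunctured

variable {lam mu : YoungDiagram} {f : ℕ × ℕ → Option ℕ} {t : ℕ × ℕ}

theorem notMem_of_eq_none (H : IsPunctured lam mu f t) {q : ℕ × ℕ} (hlt : t < q)
    (hq : f q = none) : q ∉ lam := by
  intro hmem
  obtain ⟨a, ha⟩ := (H.dom q).2 ⟨hmem, fun hmu => H.notMem (mu.isLowerSet hlt.le hmu), hlt.ne'⟩
  rw [hq] at ha
  cases ha

theorem exists_filling_eq (H : IsPunctured lam mu f t) {χ : SkewShape}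
    (hcells : χ.cells = (lam.cells \ mu.cells).erase t) : ∃ T : Tab χ, T.filling = f := by
  have hdom (p : ℕ × ℕ) : p ∈ χ.cells ↔ ∃ a, f p = some a := by
    rw [H.dom p, hcells, Finset.mem_erase, Finset.mem_sdiff, YoungDiagram.mem_cells,
      YoungDiagram.mem_cells]
    tauto
  have hnone {p : ℕ × ℕ} (hp : p ∉ χ.cells) : f p = none :=
    Option.eq_none_iff_forall_ne_some.2 fun a ha => hp ((hdom p).2 ⟨a, ha⟩)
  have hsome {p : ℕ × ℕ} (hp : p ∈ χ.cells) : f p = some ((f p).getD 0) := by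
    obtain ⟨a, ha⟩ := (hdom p).1 hp
    rw [ha, Option.getD_some]
  refine ⟨⟨fun i j => (f (i, j)).getD 0, fun hj h₁ h₂ => H.row hj (hsome h₁) (hsome h₂),
    fun hi h₁ h₂ => H.col hi (hsome h₁) (hsome h₂), fun hp => by rw [hnone hp, Option.getD_none]⟩,
    funext fun p => ?_⟩
  rw [Tab.filling]
  split_ifs with hp
  exacts [(hsome hp).symm, (hnone hp).symm]

end IsPunctured

theorem exists_inwardSlide {χ : SkewShape} (T : Tab χ) (h : χ.inner.cells.Nonempty) :
    ∃ (χ' : SkewShape) (T' : Tab χ'), InwardSlide T T' ∧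
      χ'.inner.cells.card < χ.inner.cells.card := by
  obtain ⟨s, hs, hs_down, hs_right⟩ := exists_corner h
  let mu := eraseCorner χ.inner s hs_down hs_right
  have Hs : IsPunctured χ.outer mu T.filling s := T.isPunctured_filling hs rfl
  obtain ⟨⟨f, t⟩, hsteps, hdown, hright⟩ := IsPunctured.exists_terminal (A := (_, _)) Hs
  have H : IsPunctured χ.outer mu f t := IsPunctured.of_slideSteps (A := (_, _)) Hs hsteps
  let lam := eraseCorner χ.outer t
    (H.notMem_of_eq_none (Prod.lt_iff.2 (Or.inl ⟨Nat.lt_add_one _, le_rfl⟩)) hdown)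
    (H.notMem_of_eq_none (Prod.lt_iff.2 (Or.inr ⟨le_rfl, Nat.lt_add_one _⟩)) hright)
  have hle : mu ≤ lam := fun p hp =>
    Finset.mem_erase.2 ⟨fun hpt => H.notMem (hpt ▸ hp), χ.le (Finset.mem_of_mem_erase hp)⟩
  obtain ⟨T', hT'⟩ := H.exists_filling_eq (χ := ⟨lam, mu, hle⟩) (Finset.erase_sdiff_comm _ _ _)
  exact ⟨_, T', ⟨s, t, hs, rfl, H.mem, rfl, hT' ▸ hsteps, hT' ▸ hdown, hT' ▸ hright⟩,
    Finset.card_erase_lt_of_mem hs⟩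

theorem exists_rectification {χ : SkewShape} (L : Tab χ) :
    ∃ (ν : YoungDiagram) (P : Tab (SkewShape.ofPartition ν)), SlidesTo L P := by
  induction hN : χ.inner.cells.card using Nat.strong_induction_on generalizing χ with
  | _ N ih =>
    by_cases hne : χ.inner.cells.Nonempty
    · obtain ⟨χ', T', hslide, hlt⟩ := exists_inwardSlide L hne
      obtain ⟨ν, P, hP⟩ := ih _ (hN ▸ hlt) T' rfl
      exact ⟨ν, P, Relation.ReflTransGen.head hslide hP⟩
    · obtain ⟨lam, mu, hle⟩ := χ
      obtain rfl : mu = ⊥ := YoungDiagram.ext (Finset.not_nonempty_iff_eq_empty.1 hne)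
      exact ⟨lam, L, Relation.ReflTransGen.refl⟩

/-! ### Littlewood-Richardson tableaux of partition shape -/

theorem Tab.IsLR.entry_le {χ : SkewShape} {T : Tab χ} (hT : T.IsLR) {r c : ℕ}
    (h : (r, c) ∈ χ.cells) : T.entry r c ≤ r := by
  induction r using Nat.strong_induction_on generalizing c with
  | _ r ih =>
    by_contra hlt
    obtain ⟨k, hk⟩ : ∃ k, T.entry r c = k + 1 := ⟨T.entry r c - 1, by omega⟩
    have hpos : 0 < T.prefixCount r c (k + 1) :=
      Finset.card_pos.2 ⟨(r, c), Finset.mem_filter.2 ⟨h, Or.inr ⟨rfl, le_rfl⟩, hk⟩⟩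
    obtain ⟨⟨i, j⟩, hp⟩ := Finset.card_pos.1 (hpos.trans_le (hT r c k))
    obtain ⟨hmem, hread, hij⟩ := Finset.mem_filter.1 hp
    dsimp only at hread hij
    rcases hread with hi | ⟨rfl, hj⟩
    · have := ih i hi hmem
      omega
    · rcases hj.lt_or_eq with hj | rfl
      · have := T.row_weak hj h hmem
        omega
      · omega

theorem mem_cells_ofPartition {ν : YoungDiagram} {p : ℕ × ℕ} :
    p ∈ (SkewShape.ofPartition ν).cells ↔ p ∈ ν := by
  simp [SkewShape.cells, SkewShape.ofPartition]

theorem le_entry_of_ofPartition {ν : YoungDiagram} (P : Tab (SkewShape.ofPartition ν)) {i j : ℕ}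
    (h : (i, j) ∈ ν) : i ≤ P.entry i j := by
  induction i with
  | zero => exact Nat.zero_le _
  | succ i ih =>
    have habove : (i, j) ∈ ν := ν.up_left_mem (Nat.le_succ i) le_rfl h
    exact (ih habove).trans_lt (P.col_strict (Nat.lt_add_one i) (mem_cells_ofPartition.2 habove)
      (mem_cells_ofPartition.2 h))

section Canonical

variable {ν : YoungDiagram}

theorem canonical_entry {i j : ℕ} (h : (i, j) ∈ ν) : (canonical ν).entry i j = i :=
  if_pos (mem_cells_ofPartition.2 h)

theorem isLR_canonical (ν : YoungDiagram) : (canonical ν).IsLR := by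
  rw [Tab.isLR_iff_countFromCol]
  intro j k
  refine Finset.card_le_card_of_injOn (fun p => (p.1 - 1, p.2)) ?_ ?_
  · rintro ⟨x, y⟩ hp
    simp only [Finset.coe_filter, Set.mem_ofPred_eq, mem_cells_ofPartition] at hp ⊢
    obtain ⟨hmem, hj, hk⟩ := hp
    rw [canonical_entry hmem] at hk
    have habove : (x - 1, y) ∈ ν := ν.up_left_mem (Nat.sub_le x 1) le_rfl hmem
    rw [canonical_entry habove]
    exact ⟨habove, hj, by omega⟩
  · rintro ⟨x, y⟩ hp ⟨x', y'⟩ hp' heq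
    simp only [Finset.coe_filter, Set.mem_ofPred_eq, mem_cells_ofPartition] at hp hp'
    have hx := (canonical_entry hp.1).symm.trans hp.2.2
    have hx' := (canonical_entry hp'.1).symm.trans hp'.2.2
    exact Prod.ext (hx.trans hx'.symm) (Prod.mk.inj heq).2

theorem wt_canonical (ν : YoungDiagram) (k : ℕ) : (canonical ν).wt k = ν.rowLen k := by
  rw [Tab.wt_apply, YoungDiagram.rowLen_eq_card, YoungDiagram.row]
  congr 1
  ext ⟨i, j⟩
  simp only [Finset.mem_filter, mem_cells_ofPartition, YoungDiagram.mem_cells]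
  exact and_congr_right fun h => by rw [canonical_entry h]

theorem isLR_iff_eq_canonical (P : Tab (SkewShape.ofPartition ν)) :
    P.IsLR ↔ P = canonical ν := by
  refine ⟨fun h => ?_, fun h => h ▸ isLR_canonical ν⟩
  ext i j
  by_cases hmem : (i, j) ∈ ν
  · rw [canonical_entry hmem]
    exact le_antisymm (h.entry_le (mem_cells_ofPartition.2 hmem)) (le_entry_of_ofPartition P hmem)
  · have hcell : (i, j) ∉ (SkewShape.ofPartition ν).cells := mt mem_cells_ofPartition.1 hmem
    rw [P.zeros hcell, (canonical ν).zeros hcell]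

theorem SlidesTo.isLR_iff_eq_canonical {χ : SkewShape} {L : Tab χ}
    {P : Tab (SkewShape.ofPartition ν)} (h : SlidesTo L P) : L.IsLR ↔ P = canonical ν :=
  h.isLR_iff.trans (LRRule.isLR_iff_eq_canonical P)

theorem SlidesTo.wt_eq_rowLen {χ : SkewShape} {L : Tab χ} (h : SlidesTo L (canonical ν)) (k : ℕ) :
    L.wt k = ν.rowLen k := by
  rw [← h.wt_eq, wt_canonical]

theorem setOf_slidesTo_canonical (χ : SkewShape) (ν : YoungDiagram) :
    {L : Tab χ | SlidesTo L (canonical ν)} = LR χ ν := by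
  ext L
  refine ⟨fun h => ⟨h.isLR_iff_eq_canonical.2 rfl, h.wt_eq_rowLen⟩, fun ⟨hLR, hwt⟩ => ?_⟩
  obtain ⟨ν', P, hP⟩ := exists_rectification L
  obtain rfl := hP.isLR_iff_eq_canonical.1 hLR
  obtain rfl : ν' = ν := eq_of_rowLen_eq fun k => by rw [← hP.wt_eq_rowLen, hwt]
  exact hP

end Canonical

/-! ### Finiteness -/

theorem Tab.card_cells {χ : SkewShape} (T : Tab χ) : χ.cells.card = T.wt.degree := by
  simp [Tab.wt, map_sum]

theorem card_cells_of_mem_LR {χ : SkewShape} {ν : YoungDiagram} {T : Tab χ} (h : T ∈ LR χ ν) :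
    χ.cells.card = ν.cells.card := by
  have hwt : T.wt = (canonical ν).wt := Finsupp.ext fun k => by rw [h.2 k, wt_canonical]
  have hcells : (SkewShape.ofPartition ν).cells = ν.cells := Finset.ext fun _ =>
    mem_cells_ofPartition
  rw [T.card_cells, hwt, ← (canonical ν).card_cells, hcells]

theorem finite_setOf_card_le (N : ℕ) : {ν : YoungDiagram | ν.cells.card ≤ N}.Finite := by
  refine Set.Finite.of_finite_image (f := YoungDiagram.cells)
    ((Finset.range N ×ˢ Finset.range N).powerset.finite_toSet.subset ?_)
    fun ν _ ν' _ h => YoungDiagram.ext h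
  rintro _ ⟨ν, hν : ν.cells.card ≤ N, rfl⟩
  rw [Finset.mem_coe, Finset.mem_powerset]
  rintro ⟨i, j⟩ hij
  have hcol : ν.colLen j ≤ N := ν.colLen_eq_card.trans_le ((Finset.card_filter_le _ _).trans hν)
  have hrow : ν.rowLen i ≤ N := ν.rowLen_eq_card.trans_le ((Finset.card_filter_le _ _).trans hν)
  rw [Finset.mem_product, Finset.mem_range, Finset.mem_range]
  exact ⟨(YoungDiagram.mem_iff_lt_colLen.1 hij).trans_le hcol,
    (YoungDiagram.mem_iff_lt_rowLen.1 hij).trans_le hrow⟩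

theorem finite_setOf_LR_nonempty (χ : SkewShape) :
    {ν : YoungDiagram | (LR χ ν).Nonempty}.Finite :=
  (finite_setOf_card_le χ.cells.card).subset fun _ ⟨_, hT⟩ => (card_cells_of_mem_LR hT).ge

theorem finite_setOf_LR_skew_nonempty (lam mu : YoungDiagram) :
    {ν : YoungDiagram | ∃ h : lam ≤ ν, (LR ⟨ν, lam, h⟩ mu).Nonempty}.Finite := by
  refine (finite_setOf_card_le (mu.cells.card + lam.cells.card)).subset ?_
  rintro ν ⟨h, T, hT⟩
  exact tsub_le_iff_right.1 ((Finset.le_card_sdiff lam.cells ν.cells).trans_eq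
    (card_cells_of_mem_LR hT))

theorem Tab.IsLR.entriesLT {χ : SkewShape} {T : Tab χ} (hT : T.IsLR) {n : ℕ}
    (hn : χ.outer.colLen 0 ≤ n) : T.EntriesLT n := by
  intro i c h
  have hi : i < n := by
    by_contra hge
    have hc := (χ.mem_cells_iff.1 h).2
    rw [rowLen_eq_zero (hn.trans (not_lt.1 hge))] at hc
    exact Nat.not_lt_zero c hc
  exact (hT.entry_le h).trans_lt hi

theorem finite_LR (χ : SkewShape) (ν : YoungDiagram) : (LR χ ν).Finite :=
  have : Finite {T : Tab χ | T.EntriesLT (χ.outer.colLen 0)} :=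
    Finite.of_equiv _ (Tab.chainEquiv χ le_rfl).symm
  (Set.toFinite {T : Tab χ | T.EntriesLT (χ.outer.colLen 0)}).subset
    fun _ hT => hT.1.entriesLT le_rfl

/-- Littlewood-Richardson tableaux correspond to dominant chains. -/
noncomputable def lrEquiv (χ : SkewShape) (ν : YoungDiagram) {n : ℕ}
    (hn : χ.outer.colLen 0 ≤ n) :
    LR χ ν ≃ DominantChain n χ.inner.rowLen χ.outer.rowLen 0 ν.rowLen :=
  (Equiv.subtypeSubtypeEquivSubtype (p := fun T : Tab χ => T.EntriesLT n)
    (q := fun T => T ∈ LR χ ν) fun h => h.1.entriesLT hn).symm.trans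
  ((Tab.chainEquiv χ hn).subtypeEquiv fun T =>
    and_congr T.1.isLR_iff_isRowDominant (forall_congr' fun k => by
      rw [T.1.wt_eq_chainWt hn, Pi.zero_apply, zero_add]
      rfl))

/-! ### Schur functions in finitely many variables -/

theorem InterlacingChain.coeff_genSeries (d : Fin n →₀ ℕ) :
    MvPowerSeries.coeff d (genSeries n b t) =
      Nat.card {g : InterlacingChain n b t // g.wt = d} := by
  classical
  simp only [genSeries, map_sum, coeff_expMonomial, Finset.sum_boole, eq_comm (a := ⇑d)]
  rw [← Fintype.card_subtype, ← Nat.card_eq_fintype_card]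

theorem Tab.wt_eq_embDomain_iff {χ : SkewShape} (T : Tab χ) (d : Fin n →₀ ℕ) :
    T.wt = Finsupp.embDomain Fin.valEmbedding d ↔ T.EntriesLT n ∧ ∀ x : Fin n, T.wt x = d x := by
  have hout {k : ℕ} (hk : n ≤ k) : Finsupp.embDomain Fin.valEmbedding d k = 0 :=
    Finsupp.embDomain_of_notMem_range _ _ _ fun ⟨x, hx⟩ => by
      rw [← hx] at hk
      exact x.2.not_ge hk
  have hin (x : Fin n) : Finsupp.embDomain Fin.valEmbedding d x = d x :=
    Finsupp.embDomain_apply_self Fin.valEmbedding d x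
  rw [T.entriesLT_iff_wt_eq_zero]
  refine ⟨fun h => h ▸ ⟨fun _ => hout, hin⟩, fun ⟨hzero, hlt⟩ => Finsupp.ext fun k => ?_⟩
  rcases lt_or_ge k n with hk | hk
  · exact (hlt ⟨k, hk⟩).trans (hin ⟨k, hk⟩).symm
  · rw [hzero k hk, hout hk]

theorem killCompl_schur (χ : SkewShape) (hn : χ.outer.colLen 0 ≤ n) :
    MvPowerSeries.killCompl Fin.valEmbedding (schur χ) =
      InterlacingChain.genSeries n χ.inner.rowLen χ.outer.rowLen := by
  ext d
  rw [MvPowerSeries.coeff_killCompl, InterlacingChain.coeff_genSeries]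
  change ((Nat.card {T : Tab χ // T.wt = Finsupp.embDomain Fin.valEmbedding d} : ℕ) : ℤ) = _
  simp only [Tab.wt_eq_embDomain_iff]
  refine congrArg Nat.cast (Nat.card_congr ((Equiv.subtypeSubtypeEquivSubtypeInter _ _).symm.trans
    ((Tab.chainEquiv χ hn).subtypeEquiv fun T => ?_)))
  rw [funext_iff]
  exact forall_congr' fun x => by rw [T.1.wt_eq_chainWt hn]; rfl

theorem killCompl_schur_ofPartition {ν : YoungDiagram} (hn : ν.colLen 0 ≤ n) :
    MvPowerSeries.killCompl Fin.valEmbedding (schur (SkewShape.ofPartition ν)) =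
      InterlacingChain.genSeries n 0 ν.rowLen :=
  (killCompl_schur (SkewShape.ofPartition ν) hn).trans (by rw [← rowLen_bot]; rfl)

theorem eq_of_eventually_killCompl_eq {R : Type*} [CommSemiring R] {F G : MvPowerSeries ℕ R}
    (h : ∀ᶠ n in Filter.atTop, MvPowerSeries.killCompl (Fin.valEmbedding (n := n)) F =
      MvPowerSeries.killCompl Fin.valEmbedding G) : F = G := by
  ext d
  obtain ⟨n, hFG, hn⟩ := (h.and (Filter.eventually_gt_atTop (d.support.sup id))).exists
  obtain ⟨e, rfl⟩ : d ∈ Set.range (Finsupp.embDomain (M := ℕ) (Fin.valEmbedding (n := n))) :=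
    (Finsupp.mem_range_embDomain_iff _ _).2 fun k hk =>
      ⟨⟨k, (Finset.le_sup (f := id) hk).trans_lt hn⟩, rfl⟩
  simpa only [MvPowerSeries.coeff_killCompl] using congrArg (MvPowerSeries.coeff e) hFG

/-! ### The Littlewood-Richardson rule -/

theorem exists_rowLen_eq {a : ℕ → ℕ} (ha : Antitone a) (hn : ∀ i, n ≤ i → a i = 0) :
    ∃ ν : YoungDiagram, ν.rowLen = a := by
  have hsub {i j : ℕ} (h : j < a i) : i < n ∧ j < a 0 := by
    refine ⟨?_, h.trans_le (ha (Nat.zero_le i))⟩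
    by_contra hi
    rw [hn i (not_lt.1 hi)] at h
    exact Nat.not_lt_zero j h
  let ν : YoungDiagram :=
    { cells := (Finset.range n ×ˢ Finset.range (a 0)).filter fun p => p.2 < a p.1
      isLowerSet := fun p q hqp hp => by
        have hq := (hqp.2.trans_lt (Finset.mem_filter.1 hp).2).trans_le (ha hqp.1)
        exact Finset.mem_filter.2 ⟨Finset.mem_product.2 ⟨Finset.mem_range.2 (hsub hq).1,
          Finset.mem_range.2 (hsub hq).2⟩, hq⟩ }
  refine ⟨ν, funext fun i => eq_of_forall_lt_iff fun j => ?_⟩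
  rw [← YoungDiagram.mem_iff_lt_rowLen, ← YoungDiagram.mem_cells]
  simp only [ν, Finset.mem_filter, Finset.mem_product, Finset.mem_range]
  exact and_iff_right_of_imp hsub

namespace InterlacingChain

theorem exists_rowLen_eq_add_chainWt (hn : ∀ i, n ≤ i → κ i = 0) (h : IsColDominant n κ g.val) :
    ∃ ν : YoungDiagram, ∀ k, κ k + chainWt n g.val k = ν.rowLen k := by
  obtain ⟨ν, hν⟩ := exists_rowLen_eq (n := n) (a := fun k => κ k + chainWt n g.val k)
    (antitone_nat_of_succ_le fun k => by
      simpa only [countFromCol, chainWt, mult, Nat.max_zero] using h 0 k)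
    fun k hk => by rw [hn k hk, g.chainWt_eq_zero hk]
  exact ⟨ν, fun k => (congrFun hν k).symm⟩

theorem exponent_eq_of_add_chainWt_eq {τ : ℕ → ℕ} (h : ∀ k, κ k + chainWt n g.val k = τ k) :
    exponent κ g = fun x : Fin n => τ x + staircase n x := by
  funext x
  simp only [exponent, wt, Pi.add_apply, ← h x]
  omega

theorem alternant_mul_genSeries_eq_sum_card (hκ : Antitone κ) (hn : ∀ i, n ≤ i → κ i = 0)
    (S : Finset YoungDiagram) (hS : ∀ ν, Nonempty (DominantChain n b t κ ν.rowLen) → ν ∈ S) :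
    alternant (fun x : Fin n => κ x + staircase n x) * genSeries n b t =
      ∑ ν ∈ S, Nat.card (DominantChain n b t κ ν.rowLen) •
        alternant (fun x : Fin n => ν.rowLen x + staircase n x) := by
  classical
  have hex (g : InterlacingChain n b t) (hg : IsColDominant n κ g.val) :=
    exists_rowLen_eq_add_chainWt hn hg
  choose! shape hshape using hex
  rw [alternant_mul_genSeries_eq_sum_isColDominant hκ,
    ← Finset.sum_fiberwise_of_maps_to (g := shape) (t := S) fun g hg => ?_]
  · refine Finset.sum_congr rfl fun ν _ => ?_
    have hfiber : (Finset.univ.filter fun g : InterlacingChain n b t =>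
        IsColDominant n κ g.val).filter (fun g => shape g = ν) =
          Finset.univ.filter fun g : InterlacingChain n b t =>
            IsRowDominant κ g.val ∧ ∀ k, κ k + chainWt n g.val k = ν.rowLen k := by
      ext g
      simp only [Finset.mem_filter, Finset.mem_univ, true_and, isRowDominant_iff_isColDominant]
      refine and_congr_right fun hg => ⟨fun h => h ▸ hshape g hg, fun h => ?_⟩
      exact eq_of_rowLen_eq fun k => (hshape g hg k).symm.trans (h k)
    rw [hfiber, Nat.card_eq_fintype_card, Fintype.card_subtype]
    exact Finset.sum_eq_card_nsmul fun g hg =>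
      congrArg _ (exponent_eq_of_add_chainWt_eq (Finset.mem_filter.1 hg).2.2)
  · have hdom := (Finset.mem_filter.1 hg).2
    exact hS _ ⟨⟨g, isRowDominant_iff_isColDominant.2 hdom, hshape g hdom⟩⟩

theorem genSeries_mul_genSeries (hκ : Antitone κ) (hn : ∀ i, n ≤ i → κ i = 0)
    (S : Finset YoungDiagram) (hS : ∀ ν, Nonempty (DominantChain n b t κ ν.rowLen) → ν ∈ S) :
    genSeries n 0 κ * genSeries n b t =
      ∑ ν ∈ S, Nat.card (DominantChain n b t κ ν.rowLen) • genSeries n 0 ν.rowLen := by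
  refine mul_left_cancel₀ (alternant_ne_zero (staircase_injective n)) ?_
  rw [← mul_assoc, alternant_staircase_mul_genSeries hκ hn,
    alternant_mul_genSeries_eq_sum_card hκ hn S hS, Finset.mul_sum]
  refine Finset.sum_congr rfl fun ν _ => ?_
  rw [mul_smul_comm]
  rcases isEmpty_or_nonempty (DominantChain n b t κ ν.rowLen) with hempty | ⟨⟨g⟩⟩
  · rw [Nat.card_of_isEmpty, zero_smul, zero_smul]
  · rw [alternant_staircase_mul_genSeries (antitone_rowLen ν) fun _ hi => g.eq_zero hn hi]

theorem genSeries_zero_zero : genSeries n 0 0 = 1 := by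
  refine mul_left_cancel₀ (alternant_ne_zero (staircase_injective n)) ?_
  rw [alternant_staircase_mul_genSeries (t := 0) antitone_const fun _ _ => rfl, mul_one]
  simp only [Pi.zero_apply, zero_add]

end InterlacingChain

theorem schur_eq_sum (χ : SkewShape) (S : Finset YoungDiagram)
    (hS : ∀ ν, (LR χ ν).Nonempty → ν ∈ S) :
    schur χ = ∑ ν ∈ S, (LR χ ν).ncard • schur (SkewShape.ofPartition ν) := by
  refine eq_of_eventually_killCompl_eq ?_
  filter_upwards [Filter.eventually_ge_atTop (χ.outer.colLen 0),
    S.eventually_all.2 fun ν _ => Filter.eventually_ge_atTop (ν.colLen 0)] with n hχ hSn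
  have h := InterlacingChain.genSeries_mul_genSeries (n := n) (b := χ.inner.rowLen)
    (t := χ.outer.rowLen) (κ := 0) antitone_const (fun _ _ => rfl) S
    fun ν ⟨g⟩ => hS ν ⟨_, ((lrEquiv χ ν hχ).symm g).2⟩
  rw [InterlacingChain.genSeries_zero_zero, one_mul] at h
  rw [killCompl_schur χ hχ, h, map_sum]
  refine Finset.sum_congr rfl fun ν hν => ?_
  rw [map_nsmul, killCompl_schur_ofPartition (hSn ν hν), ← Nat.card_congr (lrEquiv χ ν hχ),
    Nat.card_coe_set_eq]

open Classical in
/-- The coefficient of `s_ν` in `s_lam * s_mu`, as the Littlewood-Richardson rule predicts it: `0`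
unless `lam ≤ ν`. -/
noncomputable def lrCoeff (lam mu ν : YoungDiagram) : ℕ :=
  if h : lam ≤ ν then (LR ⟨ν, lam, h⟩ mu).ncard else 0

theorem lrCoeff_of_le {lam ν : YoungDiagram} (h : lam ≤ ν) (mu : YoungDiagram) :
    lrCoeff lam mu ν = (LR ⟨ν, lam, h⟩ mu).ncard :=
  dif_pos h

theorem exists_LR_nonempty_of_lrCoeff_ne_zero {lam mu ν : YoungDiagram}
    (h : lrCoeff lam mu ν ≠ 0) : ∃ h : lam ≤ ν, (LR ⟨ν, lam, h⟩ mu).Nonempty := by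
  by_cases hle : lam ≤ ν
  · rw [lrCoeff_of_le hle] at h
    exact ⟨hle, Set.nonempty_of_ncard_ne_zero h⟩
  · exact absurd (dif_neg hle) h

theorem lrCoeff_eq_card_dominantChain {lam mu ν : YoungDiagram} (hmu : mu.colLen 0 ≤ n)
    (hν : ν.colLen 0 ≤ n) :
    lrCoeff lam mu ν = Nat.card (DominantChain n 0 mu.rowLen lam.rowLen ν.rowLen) := by
  by_cases hle : lam ≤ ν
  · rw [lrCoeff_of_le hle, ← Nat.card_coe_set_eq]
    exact Nat.card_congr ((lrEquiv ⟨ν, lam, hle⟩ mu hν).trans (DominantChain.companionEquiv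
      (fun _ hi => rowLen_eq_zero (hν.trans hi)) fun _ hi => rowLen_eq_zero (hmu.trans hi)))
  · have : IsEmpty (DominantChain n 0 mu.rowLen lam.rowLen ν.rowLen) := ⟨fun g =>
      hle fun _ hc => YoungDiagram.mem_iff_lt_rowLen.2
        ((YoungDiagram.mem_iff_lt_rowLen.1 hc).trans_le (g.le _))⟩
    rw [Nat.card_of_isEmpty, lrCoeff, dif_neg hle]

theorem colLen_zero_le {ν : YoungDiagram} (h : ν.rowLen n = 0) : ν.colLen 0 ≤ n := by
  by_contra hlt
  have hmem : (n, 0) ∈ ν := YoungDiagram.mem_iff_lt_colLen.2 (not_le.1 hlt)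
  exact (YoungDiagram.mem_iff_lt_rowLen.1 hmem).ne' h

theorem schur_mul_schur_eq_sum (lam mu : YoungDiagram) (S : Finset YoungDiagram)
    (hS : ∀ ν, lrCoeff lam mu ν ≠ 0 → ν ∈ S) :
    schur (SkewShape.ofPartition lam) * schur (SkewShape.ofPartition mu) =
      ∑ ν ∈ S, lrCoeff lam mu ν • schur (SkewShape.ofPartition ν) := by
  refine eq_of_eventually_killCompl_eq ?_
  filter_upwards [Filter.eventually_ge_atTop (lam.colLen 0),
    Filter.eventually_ge_atTop (mu.colLen 0),
    S.eventually_all.2 fun ν _ => Filter.eventually_ge_atTop (ν.colLen 0)] with n hlam hmu hSn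
  have hzero (i : ℕ) (hi : n ≤ i) : lam.rowLen i = 0 := rowLen_eq_zero (hlam.trans hi)
  have hmem (ν : YoungDiagram)
      (hne : Nonempty (DominantChain n 0 mu.rowLen lam.rowLen ν.rowLen)) : ν ∈ S := by
    obtain ⟨g⟩ := hne
    refine hS ν ?_
    rw [lrCoeff_eq_card_dominantChain hmu (colLen_zero_le (g.eq_zero hzero le_rfl))]
    exact Nat.card_ne_zero.2 ⟨⟨g⟩, inferInstance⟩
  rw [map_mul, killCompl_schur_ofPartition hlam, killCompl_schur_ofPartition hmu, map_sum,
    InterlacingChain.genSeries_mul_genSeries (antitone_rowLen lam) hzero S hmem]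
  refine Finset.sum_congr rfl fun ν hν => ?_
  rw [map_nsmul, killCompl_schur_ofPartition (hSn ν hν),
    lrCoeff_eq_card_dominantChain hmu (hSn ν hν)]

theorem schur_eq_finsum (χ : SkewShape) :
    schur χ = ∑ᶠ ν : YoungDiagram, (LR χ ν).ncard • schur (SkewShape.ofPartition ν) := by
  have hS {ν : YoungDiagram} (hν : (LR χ ν).Nonempty) :
      ν ∈ (finite_setOf_LR_nonempty χ).toFinset := (Set.Finite.mem_toFinset _).2 hν
  rw [schur_eq_sum χ _ fun ν => hS]
  refine (finsum_eq_sum_of_support_subset _ fun ν hν => hS ?_).symm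
  exact Set.nonempty_of_ncard_ne_zero (left_ne_zero_of_smul hν)

theorem schur_mul_schur_eq_finsum (lam mu : YoungDiagram) :
    schur (SkewShape.ofPartition lam) * schur (SkewShape.ofPartition mu) =
      ∑ᶠ (ν : YoungDiagram) (h : lam ≤ ν),
        (LR ⟨ν, lam, h⟩ mu).ncard • schur (SkewShape.ofPartition ν) := by
  have hterm (ν : YoungDiagram) :
      ∑ᶠ h : lam ≤ ν, (LR ⟨ν, lam, h⟩ mu).ncard • schur (SkewShape.ofPartition ν) =
        lrCoeff lam mu ν • schur (SkewShape.ofPartition ν) := by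
    classical
    rw [finsum_eq_dif, lrCoeff]
    split_ifs
    exacts [rfl, (zero_smul _ _).symm]
  have hS {ν : YoungDiagram} (hν : lrCoeff lam mu ν ≠ 0) :
      ν ∈ (finite_setOf_LR_skew_nonempty lam mu).toFinset :=
    (Set.Finite.mem_toFinset _).2 (exists_LR_nonempty_of_lrCoeff_ne_zero hν)
  simp only [hterm]
  rw [schur_mul_schur_eq_sum lam mu _ fun ν => hS]
  exact (finsum_eq_sum_of_support_subset _ fun ν hν => hS (left_ne_zero_of_smul hν)).symm

end LRRule

open LRRule in
theorem mainTheorem2 :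
    -- jeu de taquin preserves the property of being a Littlewood-Richardson tableau
    (∀ (χ χ' : SkewShape) (T : Tab χ) (T' : Tab χ'), SlidesTo T T' → (T.IsLR ↔ T'.IsLR)) ∧
    -- every tableau can be rectified
    (∀ (χ : SkewShape) (L : Tab χ),
      ∃ (ν : YoungDiagram) (P : Tab (SkewShape.ofPartition ν)), SlidesTo L P) ∧
    -- a rectification is canonical exactly when one starts from a Littlewood-Richardson tableau,
    -- and its shape is then the weight of that tableau
    (∀ (χ : SkewShape) (L : Tab χ) (ν : YoungDiagram) (P : Tab (SkewShape.ofPartition ν)),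
      SlidesTo L P →
        (L.IsLR ↔ P = canonical ν) ∧ (L.IsLR → ∀ k, L.wt k = ν.rowLen k)) ∧
    -- the fibre equation
    (∀ (χ : SkewShape) (ν : YoungDiagram), {L : Tab χ | SlidesTo L (canonical ν)} = LR χ ν) ∧
    -- the Littlewood-Richardson rule for skew Schur functions
    (∀ χ : SkewShape,
      {ν : YoungDiagram | (LR χ ν).Nonempty}.Finite ∧
      (∀ ν : YoungDiagram, (LR χ ν).Finite) ∧
      schur χ =
        ∑ᶠ ν : YoungDiagram, (LR χ ν).ncard • schur (SkewShape.ofPartition ν)) ∧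
    -- the Littlewood-Richardson rule for products of Schur functions
    (∀ lam mu : YoungDiagram,
      {ν : YoungDiagram | ∃ h : lam ≤ ν, (LR ⟨ν, lam, h⟩ mu).Nonempty}.Finite ∧
      schur (SkewShape.ofPartition lam) * schur (SkewShape.ofPartition mu) =
        ∑ᶠ (ν : YoungDiagram) (h : lam ≤ ν),
          (LR ⟨ν, lam, h⟩ mu).ncard • schur (SkewShape.ofPartition ν)) := by
  refine ⟨fun χ χ' T T' h => h.isLR_iff, fun χ L => exists_rectification L,
    fun χ L ν P h => ⟨h.isLR_iff_eq_canonical, fun hL => ?_⟩, setOf_slidesTo_canonical,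
    fun χ => ⟨finite_setOf_LR_nonempty χ, finite_LR χ, schur_eq_finsum χ⟩,
    fun lam mu => ⟨finite_setOf_LR_skew_nonempty lam mu, schur_mul_schur_eq_finsum lam mu⟩⟩
  obtain rfl := h.isLR_iff_eq_canonical.1 hL
  exact h.wt_eq_rowLen
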